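/- Let $P\subset\mathbb R^n$ be a simple convex $n$-dimensional polytope, i.e. a bounded intersection of finitely many closed half-spaces with nonempty interior, every vertex of which lies in exactly $n$ facets. For a polytope $C$ let $\mathcal F(C)$ be its set of facets (faces of codimension one). The nerve complex $K_C$ is the simplicial complex on the vertex set $\mathcal F(C)$ whose simplices are the sets of facets with nonempty common intersection. Suppose that $P$ is flag, i.e. every minimal nonface $J$ of $K_P$ with $|J|\ge 2$ (a non-simplex all of whose proper subsets are simplices) has $|J|=2$. Let $F$ be a nonempty face of $P$. For $C\in\{F,P\}$ let $\mathcal Z_C=(T^{\mathcal F(C)}\times C)/\!\sim$ be the moment-angle manifold, where $T=S^1$ and $(t,p)\sim(s,q)$ iff $p=q$ and $t_G=s_G$ for every facet $G\not\ni p$. For a simplicial complex $K$ on a vertex set $V$ let $\mathcal Z_K=\bigcup_{\sigma\in K}\{z\in\mathbb C^V:\ |z_i|\le 1\ (i\in\sigma),\ |z_i|=1\ (i\notin\sigma)\}$ be its moment-angle-complex (the union includes $\sigma=\varnothing$). Then there is a unique map $\varphi\colon\mathcal F(F)\to\mathcal F(P)$ with $G=F\cap\varphi(G)$ for all $G\in\mathcal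 F(F)$. It induces an injective simplicial map $\Phi\colon K_F\to K_P$; a map $\hat i\colon\mathcal Z_F\to\mathcal Z_P$, $[t,p]\mapsto[\tilde\varphi(t),p]$; and a map $\hat\Phi\colon\mathcal Z_{K_F}\to\mathcal Z_{K_P}$, $z\mapsto\tilde\varphi(z)$. Here $\tilde\varphi(z)_{\varphi(G)}=z_G$, and all coordinates of $\tilde\varphi(z)$ outside the image of $\varphi$ are $1$. Moreover: 1. $\Phi(K_F)$ is the full subcomplex of $K_P$ on the vertex set $\varphi(\mathcal F(F))$. 2. There are homeomorphisms $H_1\colon\mathcal Z_F\to\mathcal Z_{K_F}$ and $H_2\colon\mathcal Z_P\to\mathcal Z_{K_P}$ with $H_2\circ\hat i=\hat\Phi\circ H_1$. 3. $\hat i$ has a retraction: there is a continuous $\rho\colon\mathcal Z_P\to\mathcal Z_F$ with $\rho\circ\hat i=\mathrm{id}$. 4. For every commutative ring $R$ with unit, the ring homomorphism $\hat i^*\colon H^*(\mathcal Z_P;R)\to H^*(\mathcal Z_F;R)$ in singular cohomology is a split epimorphism of graded rings: there is a homomorphism of graded $R$-algebras $s$ with $\hat i^*\circ s=\mathrm{id}$.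 -/

import Mathlib

noncomputable section

/-! ### Faces, facets, simple polytopes -/

section Polytopes

variable {E : Type} [NormedAddCommGroup E] [NormedSpace ℝ E]

/-- `F` is a nonempty face of the convex set `C`: the set of points of `C` at which some linear
functional attains its maximum on `C` (the zero functional gives `C` itself). -/
def IsFace (C F : Set E) : Prop :=
  F.Nonempty ∧ IsExposed ℝ C F

/-- The dimension of a set, i.e. of its affine hull. -/
def setDim (C : Set E) : ℕ :=
  Module.finrank ℝ (vectorSpan ℝ C)

/-- A facet is a nonempty face of codimension one. -/
def IsFacet (C G : Set E) : Prop :=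
  IsFace C G ∧ setDim G + 1 = setDim C

/-- The set `𝓕(C)` of facets of `C`. -/
def Facet (C : Set E) : Type :=
  {G : Set E // IsFacet C G}

instance (C : Set E) : CoeOut (Facet C) (Set E) := ⟨Subtype.val⟩

theorem Facet.subset {C : Set E} (G : Facet C) : (G : Set E) ⊆ C :=
  G.2.1.2.subset

/-- A simple convex `n`-dimensional polytope in `ℝⁿ`: a bounded intersection of finitely many
closed half-spaces, with nonempty interior, such that every vertex lies in exactly `n` facets. -/
structure IsSimplePolytope {n : ℕ} (P : Set (EuclideanSpace ℝ (Fin n))) : Prop where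
  halfspaces : ∃ (m : ℕ) (a : Fin m → EuclideanSpace ℝ (Fin n)) (b : Fin m → ℝ),
    P = {x | ∀ i, 0 ≤ inner ℝ (a i) x + b i}
  bounded : Bornology.IsBounded P
  full_dim : (interior P).Nonempty
  simple : ∀ v ∈ P.extremePoints ℝ, {G : Set (EuclideanSpace ℝ (Fin n)) | IsFacet P G ∧ v ∈ G}.encard = n

end Polytopes

/-! ### Simplicial complexes

Simplicial complexes are Mathlib's `PreAbstractSimplicialComplex`, whose simplices are the
*nonempty* members of the complex; the empty simplex always belongs to a complex and is not
recorded. -/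

section Complexes

variable {V W : Type}

/-- The full subcomplex `K_S` of `K` on the set of vertices `S`. -/
def fullSubcomplex (K : PreAbstractSimplicialComplex V) (S : Set V) :
    PreAbstractSimplicialComplex V where
  faces := {σ | σ ∈ K ∧ (σ : Set V) ⊆ S}
  isRelLowerSet_faces := by
    rintro σ ⟨hσ, hS⟩
    refine ⟨(K.isRelLowerSet_faces hσ).1, fun τ hτ hne => ⟨(K.isRelLowerSet_faces hσ).2 hτ hne, ?_⟩⟩
    exact (Finset.coe_subset.mpr hτ).trans hS

/-- The image of `K` under a map of vertices. -/
def imageComplex (φ : V → W) (K : PreAbstractSimplicialComplex V) :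
    PreAbstractSimplicialComplex W :=
  open Classical in K.map φ

/-- `J` is a minimal nonface of `K`: `|J| ≥ 2` and `K_J` is the boundary of the simplex on `J`. -/
def IsMinimalNonface (K : PreAbstractSimplicialComplex V) (J : Finset V) : Prop :=
  2 ≤ J.card ∧ ∀ τ : Finset V, τ.Nonempty → τ ⊆ J → (τ ∈ K ↔ τ ≠ J)

/-- A complex is flag if all its minimal nonfaces have two elements. -/
def IsFlagComplex (K : PreAbstractSimplicialComplex V) : Prop :=
  ∀ J : Finset V, IsMinimalNonface K J → J.card = 2

/-- `φ` is injective on vertices and maps simplices of `K` to simplices of `L`, i.e. it defines a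
nondegenerate injective simplicial map `K → L`. -/
structure IsSimplicialEmbedding (K : PreAbstractSimplicialComplex V)
    (L : PreAbstractSimplicialComplex W) (φ : V → W) : Prop where
  injective : Function.Injective φ
  simplicial : imageComplex φ K ≤ L

/-- The moment-angle-complex `𝒵_K = ⋃_{σ ∈ K} (D², S¹)^σ ⊆ (D²)^V ⊆ ℂ^V`. The union includes the
empty simplex. -/
def MomentAngleComplex (K : PreAbstractSimplicialComplex V) : Set (V → ℂ) :=
  {z | ∃ σ : Finset V, (σ.Nonempty → σ ∈ K) ∧ (∀ i ∈ σ, ‖z i‖ ≤ 1) ∧ ∀ i ∉ σ, ‖z i‖ = 1}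

/-- Extension by `1` along an injective map of index sets is continuous. -/
theorem continuous_extend_one {M : Type} [TopologicalSpace M] [One M] {φ : V → W}
    (hφ : Function.Injective φ) : Continuous fun z : V → M => Function.extend φ z 1 := by
  refine continuous_pi fun j => ?_
  by_cases hj : ∃ i, φ i = j
  · obtain ⟨i, rfl⟩ := hj
    simpa only [hφ.extend_apply] using continuous_apply i
  · simpa only [Function.extend_apply' _ _ _ hj] using continuous_const

theorem extend_one_mem {K : PreAbstractSimplicialComplex V} {L : PreAbstractSimplicialComplex W}
    {φ : V → W} (hφ : IsSimplicialEmbedding K L φ) {z : V → ℂ} (hz : z ∈ MomentAngleComplex K) :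
    Function.extend φ z 1 ∈ MomentAngleComplex L := by
  classical
  obtain ⟨σ, hσ, h1, h2⟩ := hz
  refine ⟨σ.image φ, fun hne => ?_, fun j hj => ?_, fun j hj => ?_⟩
  · refine hφ.simplicial ⟨σ, hσ (Finset.image_nonempty.mp hne), ?_⟩
    ext; simp
  · obtain ⟨i, hi, rfl⟩ := Finset.mem_image.mp hj
    rw [hφ.injective.extend_apply]
    exact h1 i hi
  · by_cases hj' : ∃ i, φ i = j
    · obtain ⟨i, rfl⟩ := hj'
      rw [hφ.injective.extend_apply]
      exact h2 i fun hi => hj (Finset.mem_image_of_mem φ hi)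
    · rw [Function.extend_apply' _ _ _ hj']
      simp

/-- The map `𝒵_K → 𝒵_L` induced by an injective simplicial map: it puts the coordinate of the vertex
`i` in the place `φ i`, and `1` in the places of the vertices outside the image of `φ`. -/
def MomentAngleComplex.map {K : PreAbstractSimplicialComplex V}
    {L : PreAbstractSimplicialComplex W} {φ : V → W} (hφ : IsSimplicialEmbedding K L φ) :
    C(MomentAngleComplex K, MomentAngleComplex L) where
  toFun z := ⟨Function.extend φ (z : V → ℂ) 1, extend_one_mem hφ z.2⟩
  continuous_toFun :=
    ((continuous_extend_one hφ.injective).comp continuous_subtype_val).subtype_mk _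

end Complexes

/-! ### Nerve complexes and moment-angle manifolds -/

section MomentAngle

variable {E : Type} [NormedAddCommGroup E] [NormedSpace ℝ E]

/-- The nerve complex `K_C`: its vertices are the facets of `C`, and a set of facets is a simplex if
these facets have a common point. -/
def nerveComplex (C : Set E) : PreAbstractSimplicialComplex (Facet C) where
  faces := {σ | σ.Nonempty ∧ (⋂ G ∈ σ, (G : Set E)).Nonempty}
  isRelLowerSet_faces := by
    rintro σ ⟨hne, x, hx⟩
    refine ⟨hne, fun τ hτ hne' => ⟨hne', x, ?_⟩⟩
    simp only [Set.mem_iInter] at hx ⊢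
    exact fun G hG => hx G (hτ hG)

/-- The relation on `T^{𝓕(C)} × C`: `(t, p) ∼ (s, q)` if `p = q` and `t s⁻¹` lies in the coordinate
subtorus of the facets that contain the minimal face of `p`, i.e. of the facets through `p`. -/
def momentAngleSetoid (C : Set E) : Setoid ((Facet C → Circle) × C) where
  r x y := x.2 = y.2 ∧ ∀ G : Facet C, (x.2 : E) ∉ (G : Set E) → (x.1 * y.1⁻¹) G = 1
  iseqv :=
    { refl := fun x => ⟨rfl, fun G _ => by simp⟩
      symm := by
        rintro ⟨t, p⟩ ⟨s, q⟩ ⟨h, h'⟩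
        obtain rfl : p = q := h
        refine ⟨rfl, fun G hG => ?_⟩
        have := h' G hG
        simp only [Pi.mul_apply, Pi.inv_apply, mul_inv_eq_one] at this ⊢
        exact this.symm
      trans := by
        rintro ⟨t, p⟩ ⟨s, q⟩ ⟨u, w⟩ ⟨h, h'⟩ ⟨k, k'⟩
        obtain rfl : p = q := h
        obtain rfl : p = w := k
        refine ⟨rfl, fun G hG => ?_⟩
        have h1 := h' G hG
        have h2 := k' G hG
        simp only [Pi.mul_apply, Pi.inv_apply, mul_inv_eq_one] at h1 h2 ⊢
        exact h1.trans h2 }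

/-- The moment-angle manifold `𝒵_C = (T^{𝓕(C)} × C) / ∼`, with the quotient topology. -/
def MomentAngleManifold (C : Set E) : Type :=
  Quotient (momentAngleSetoid C)

instance (C : Set E) : TopologicalSpace (MomentAngleManifold C) :=
  inferInstanceAs (TopologicalSpace (Quotient (momentAngleSetoid C)))

/-- `φ : 𝓕(F) → 𝓕(P)` sends every facet `G` of `F` to a facet of `P` which cuts `G` out of `F`. -/
def IsFacetMap (P F : Set E) (φ : Facet F → Facet P) : Prop :=
  ∀ G : Facet F, (G : Set E) = F ∩ (φ G : Set E)

theorem IsFacetMap.injective {P F : Set E} {φ : Facet F → Facet P} (hφ : IsFacetMap P F φ) :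
    Function.Injective φ := fun G G' h =>
  Subtype.ext ((hφ G).trans (by rw [h]; exact (hφ G').symm))

/-- The facet map defines a nondegenerate injective simplicial map `Φ : K_F → K_P`. -/
theorem IsFacetMap.isSimplicialEmbedding {P F : Set E} {φ : Facet F → Facet P}
    (hφ : IsFacetMap P F φ) : IsSimplicialEmbedding (nerveComplex F) (nerveComplex P) φ := by
  classical
  refine ⟨hφ.injective, ?_⟩
  rintro _ ⟨σ, ⟨hne, x, hx⟩, rfl⟩
  refine ⟨by simpa using hne, x, ?_⟩
  simp only [Set.mem_iInter, Finset.mem_image, forall_exists_index, and_imp] at hx ⊢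
  rintro _ G hG rfl
  have := hx G hG
  rw [hφ G] at this
  exact this.2

/-- The map `𝒵_F → 𝒵_P` induced by the inclusion `F ⊆ P` of a face,
`[t, p] ↦ [φ̃ t, p]` where `φ̃ t` is `t` in the places `φ G` and `1` in the other places. -/
def faceEmbedding {P F : Set E} (hFP : F ⊆ P) {φ : Facet F → Facet P}
    (hφ : IsFacetMap P F φ) : C(MomentAngleManifold F, MomentAngleManifold P) where
  toFun := Quotient.map'
    (s₁ := momentAngleSetoid F) (s₂ := momentAngleSetoid P)
    (fun x => (Function.extend φ x.1 1, Set.inclusion hFP x.2)) (by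
      rintro ⟨t, p⟩ ⟨s, q⟩ ⟨h, h'⟩
      obtain rfl : p = q := h
      refine ⟨rfl, fun j hj => ?_⟩
      by_cases hj' : ∃ G, φ G = j
      · obtain ⟨G, rfl⟩ := hj'
        have hG : (p : E) ∉ (G : Set E) := fun hp => hj (by rw [hφ G] at hp; exact hp.2)
        have := h' G hG
        simpa [hφ.injective.extend_apply] using this
      · simp [Function.extend_apply' _ _ _ hj'])
  continuous_toFun := by
    refine Continuous.quotient_map' ?_ _
    exact ((continuous_extend_one hφ.injective).comp continuous_fst).prodMk
      ((continuous_inclusion hFP).comp continuous_snd)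

end MomentAngle

/-! ### The singular cohomology ring -/

section Cohomology

open CategoryTheory Opposite
open scoped Simplicial

universe u

variable (R : Type u) [CommRing R]

/-- Cochains on a simplicial set with coefficients in `R`. -/
abbrev Cochain (S : SSet.{0}) (p : ℕ) : Type u :=
  S _⦋p⦌ → R

variable {R} {S T : SSet.{0}}

/-- The coboundary `(δ f)(x) = ∑ i, (-1)ⁱ f(dᵢ x)`. -/
def coboundary (p : ℕ) : Cochain R S p →ₗ[R] Cochain R S (p + 1) where
  toFun f x := ∑ i : Fin (p + 2), (-1) ^ (i : ℕ) * f (S.δ i x)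
  map_add' f g := by ext x; simp [mul_add, Finset.sum_add_distrib]
  map_smul' c f := by
    ext x
    simp only [Pi.smul_apply, smul_eq_mul, RingHom.id_apply, Finset.mul_sum]
    exact Finset.sum_congr rfl fun i _ => by ring

variable (R S) in
/-- Cocycles of degree `p`. -/
def cocycles (p : ℕ) : Submodule R (Cochain R S p) :=
  LinearMap.ker (coboundary p)

variable (R S) in
/-- Coboundaries of degree `p`. -/
def coboundaries (p : ℕ) : Submodule R (Cochain R S p) :=
  match p with
  | 0 => ⊥
  | p + 1 => LinearMap.range (coboundary p)

variable (R S) in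
/-- The cohomology `Hᵖ(S; R)`: cocycles modulo coboundaries. -/
abbrev SimplicialCohomology (p : ℕ) : Type u :=
  cocycles R S p ⧸ (coboundaries R S p).submoduleOf (cocycles R S p)

/-- The front face on the first `p + 1` vertices of an `n`-simplex, `n = p + q`. -/
def frontFace {p q n : ℕ} (h : p + q = n) (x : S _⦋n⦌) : S _⦋p⦌ :=
  S.map (SimplexCategory.subinterval (n := n) 0 p (by lia)).op x

/-- The back face on the last `q + 1` vertices of an `n`-simplex, `n = p + q`. -/
def backFace {p q n : ℕ} (h : p + q = n) (x : S _⦋n⦌) : S _⦋q⦌ :=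
  S.map (SimplexCategory.subinterval (n := n) p q (by lia)).op x

/-- The Alexander–Whitney cup product of cochains. -/
def cochainCup {p q n : ℕ} (h : p + q = n) :
    Cochain R S p →ₗ[R] Cochain R S q →ₗ[R] Cochain R S n :=
  LinearMap.mk₂ R (fun f g x => f (frontFace h x) * g (backFace h x))
    (fun _ _ _ => by ext x; simp [add_mul]) (fun _ _ _ => by ext x; simp [mul_assoc])
    (fun _ _ _ => by ext x; simp [mul_add])
    (fun _ _ _ => by ext x; simp only [Pi.smul_apply, smul_eq_mul]; ring)

theorem map_comp_apply {a b c : ℕ} (α : ⦋a⦌ ⟶ ⦋b⦌) (β : ⦋b⦌ ⟶ ⦋c⦌) (x : S _⦋c⦌) :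
    S.map α.op (S.map β.op x) = S.map (α ≫ β).op x := by
  simp

theorem subinterval_val {a j l : ℕ} (h : j + l ≤ a) (i : Fin (l + 1)) :
    ((SimplexCategory.Hom.toOrderHom (SimplexCategory.subinterval (n := a) j l h) i : Fin (a + 1)) : ℕ) =
      (i : ℕ) + j := rfl

theorem δ_val {a : ℕ} (i : Fin (a + 2)) (j : Fin (a + 1)) :
    ((SimplexCategory.Hom.toOrderHom (SimplexCategory.δ i) j : Fin (a + 2)) : ℕ) =
      if (j : ℕ) < i then (j : ℕ) else j + 1 := by
  change ((i.succAbove j : Fin (a + 2)) : ℕ) = _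
  simp only [Fin.succAbove, Fin.lt_def, Fin.val_castSucc]
  split_ifs <;> simp

theorem frontFace_δ_of_le {p q n : ℕ} (h : p + q = n) (i : Fin (n + 2)) (hi : (i : ℕ) ≤ p)
    (x : S _⦋n + 1⦌) : frontFace h (S.δ i x) =
      S.δ ⟨i, by lia⟩ (frontFace (show p + 1 + q = n + 1 by lia) x) := by
  simp only [frontFace, SimplicialObject.δ, map_comp_apply]
  congr 3
  apply Quiver.Hom.unop_inj
  ext j
  have := j.isLt
  simp at this ⊢
  repeat rw [δ_val]
  repeat rw [subinterval_val]
  repeat rw [δ_val]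
  try split_ifs <;> lia

theorem backFace_δ_of_le {p q n : ℕ} (h : p + q = n) (i : Fin (n + 2)) (hi : (i : ℕ) ≤ p)
    (x : S _⦋n + 1⦌) : backFace h (S.δ i x) =
      backFace (show p + 1 + q = n + 1 by lia) x := by
  simp only [backFace, SimplicialObject.δ, map_comp_apply]
  congr 3
  apply Quiver.Hom.unop_inj
  ext j
  have := j.isLt
  simp at this ⊢
  repeat rw [δ_val]
  repeat rw [subinterval_val]
  repeat rw [δ_val]
  try simp only [Fin.val_last, Fin.val_zero]
  try split_ifs <;> lia

theorem frontFace_δ_of_lt {p q n : ℕ} (h : p + q = n) (i : Fin (n + 2)) (hi : p < (i : ℕ))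
    (x : S _⦋n + 1⦌) : frontFace h (S.δ i x) =
      frontFace (show p + (q + 1) = n + 1 by lia) x := by
  simp only [frontFace, SimplicialObject.δ, map_comp_apply]
  congr 3
  apply Quiver.Hom.unop_inj
  ext j
  have := j.isLt
  simp at this ⊢
  repeat rw [δ_val]
  repeat rw [subinterval_val]
  repeat rw [δ_val]
  try simp only [Fin.val_last, Fin.val_zero]
  try split_ifs <;> lia

theorem backFace_δ_of_lt {p q n : ℕ} (h : p + q = n) (i : Fin (n + 2)) (j : Fin (q + 2))
    (hi : (i : ℕ) = p + j) (x : S _⦋n + 1⦌) : backFace h (S.δ i x) =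
      S.δ j (backFace (show p + (q + 1) = n + 1 by lia) x) := by
  simp only [backFace, SimplicialObject.δ, map_comp_apply]
  congr 3
  apply Quiver.Hom.unop_inj
  ext k
  have := k.isLt
  simp at this ⊢
  repeat rw [δ_val]
  repeat rw [subinterval_val]
  repeat rw [δ_val]
  try simp only [Fin.val_last, Fin.val_zero]
  try split_ifs <;> lia

theorem δ_last_frontFace {p q n : ℕ} (h : p + q = n) (x : S _⦋n + 1⦌) :
    S.δ (Fin.last (p + 1)) (frontFace (show p + 1 + q = n + 1 by lia) x) =
      frontFace (show p + (q + 1) = n + 1 by lia) x := by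
  simp only [frontFace, SimplicialObject.δ, map_comp_apply]
  congr 3
  apply Quiver.Hom.unop_inj
  ext k
  have := k.isLt
  simp at this ⊢
  repeat rw [δ_val]
  repeat rw [subinterval_val]
  repeat rw [δ_val]
  try simp only [Fin.val_last, Fin.val_zero]
  try split_ifs <;> lia

theorem δ_zero_backFace {p q n : ℕ} (h : p + q = n) (x : S _⦋n + 1⦌) :
    S.δ 0 (backFace (show p + (q + 1) = n + 1 by lia) x) =
      backFace (show p + 1 + q = n + 1 by lia) x := by
  simp only [backFace, SimplicialObject.δ, map_comp_apply]
  congr 3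
  apply Quiver.Hom.unop_inj
  ext k
  have := k.isLt
  simp at this ⊢
  repeat rw [δ_val]
  repeat rw [subinterval_val]
  repeat rw [δ_val]
  try simp only [Fin.val_last, Fin.val_zero]
  try split_ifs <;> lia

/-- The Leibniz rule. -/
theorem coboundary_cochainCup {p q n : ℕ} (h : p + q = n) (f : Cochain R S p)
    (g : Cochain R S q) :
    coboundary n (cochainCup h f g) =
      cochainCup (show p + 1 + q = n + 1 by lia) (coboundary p f) g +
        (-1 : R) ^ p • cochainCup (show p + (q + 1) = n + 1 by lia) f (coboundary q g) := by
  ext x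
  simp only [coboundary, cochainCup, LinearMap.coe_mk, AddHom.coe_mk, LinearMap.mk₂_apply,
    Pi.add_apply, Pi.smul_apply, smul_eq_mul]
  rw [← Fin.sum_congr' _ (show (p + 1) + (q + 1) = n + 2 by lia), Fin.sum_univ_add,
    Fin.sum_univ_castSucc (n := p + 1), Fin.sum_univ_succ (n := q + 1), δ_last_frontFace h,
    δ_zero_backFace h]
  have h1 : ∀ i : Fin (p + 1), (-1 : R) ^ (i : ℕ) *
      (f (frontFace h (S.δ (Fin.cast (show (p + 1) + (q + 1) = n + 2 by lia)
          (Fin.castAdd (q + 1) i)) x)) *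
        g (backFace h (S.δ (Fin.cast (show (p + 1) + (q + 1) = n + 2 by lia)
          (Fin.castAdd (q + 1) i)) x))) =
      (-1) ^ (i : ℕ) * f (S.δ i.castSucc (frontFace (show p + 1 + q = n + 1 by lia) x)) *
        g (backFace (show p + 1 + q = n + 1 by lia) x) := by
    intro i
    rw [frontFace_δ_of_le h _ (by simp; lia), backFace_δ_of_le h _ (by simp; lia), mul_assoc]
    rfl
  have h2 : ∀ j : Fin (q + 1), (-1 : R) ^ (p + 1 + (j : ℕ)) *
      (f (frontFace h (S.δ (Fin.cast (show (p + 1) + (q + 1) = n + 2 by lia)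
          (Fin.natAdd (p + 1) j)) x)) *
        g (backFace h (S.δ (Fin.cast (show (p + 1) + (q + 1) = n + 2 by lia)
          (Fin.natAdd (p + 1) j)) x))) =
      (-1) ^ p * (f (frontFace (show p + (q + 1) = n + 1 by lia) x) *
        ((-1) ^ ((j : ℕ) + 1) * g (S.δ j.succ (backFace (show p + (q + 1) = n + 1 by lia) x)))) := by
    intro j
    rw [frontFace_δ_of_lt h _ (by simp; lia), backFace_δ_of_lt h _ j.succ (by simp; lia)]
    ring
  simp only [Fin.val_cast, Fin.val_castAdd, Fin.val_natAdd, Fin.val_castSucc, Fin.val_last,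
    Fin.val_succ, Fin.val_zero, h1, h2, add_mul, mul_add, Finset.sum_mul, Finset.mul_sum]
  ring

theorem coboundary_mem_coboundaries {p : ℕ} (f : Cochain R S p) :
    coboundary p f ∈ coboundaries R S (p + 1) := ⟨f, rfl⟩

theorem cochainCup_mem_cocycles {p q n : ℕ} (h : p + q = n) {f : Cochain R S p}
    {g : Cochain R S q} (hf : f ∈ cocycles R S p) (hg : g ∈ cocycles R S q) :
    cochainCup h f g ∈ cocycles R S n := by
  rw [cocycles, LinearMap.mem_ker] at *
  rw [coboundary_cochainCup, hf, hg]
  simp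

theorem cochainCup_mem_coboundaries_left {p q n : ℕ} (h : p + q = n) {f : Cochain R S p}
    {g : Cochain R S q} (hf : f ∈ coboundaries R S p) (hg : g ∈ cocycles R S q) :
    cochainCup h f g ∈ coboundaries R S n := by
  cases p with
  | zero =>
    obtain rfl : f = 0 := hf
    rw [map_zero]
    exact zero_mem _
  | succ p =>
    obtain ⟨e, rfl⟩ := hf
    obtain ⟨k, rfl⟩ : ∃ k, n = k + 1 := ⟨p + q, by lia⟩
    have key := coboundary_cochainCup (show p + q = k by lia) e g
    rw [cocycles, LinearMap.mem_ker] at hg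
    rw [hg, map_zero, smul_zero, add_zero] at key
    rw [← key]
    exact coboundary_mem_coboundaries _

theorem cochainCup_mem_coboundaries_right {p q n : ℕ} (h : p + q = n) {f : Cochain R S p}
    {g : Cochain R S q} (hf : f ∈ cocycles R S p) (hg : g ∈ coboundaries R S q) :
    cochainCup h f g ∈ coboundaries R S n := by
  cases q with
  | zero =>
    obtain rfl : g = 0 := hg
    rw [map_zero]
    exact zero_mem _
  | succ q =>
    obtain ⟨e, rfl⟩ := hg
    obtain ⟨k, rfl⟩ : ∃ k, n = k + 1 := ⟨p + q, by lia⟩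
    have key := coboundary_cochainCup (show p + q = k by lia) f e
    rw [cocycles, LinearMap.mem_ker] at hf
    rw [hf, map_zero, LinearMap.zero_apply, zero_add] at key
    have key' : cochainCup h f (coboundary q e) =
        (-1 : R) ^ p • coboundary k (cochainCup (show p + q = k by lia) f e) := by
      rw [key, smul_smul, ← mul_pow]
      simp
    rw [key']
    exact Submodule.smul_mem _ _ (coboundary_mem_coboundaries _)

/-- The class of the cup product of two cocycles. -/
def cocycleCup {p q n : ℕ} (h : p + q = n) :
    cocycles R S p →ₗ[R] cocycles R S q →ₗ[R] SimplicialCohomology R S n :=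
  LinearMap.mk₂ R
    (fun f g => Submodule.Quotient.mk ⟨cochainCup h f g, cochainCup_mem_cocycles h f.2 g.2⟩)
    (fun f f' g => by
      rw [← Submodule.Quotient.mk_add]; congr 1; ext1; simp)
    (fun c f g => by
      rw [← Submodule.Quotient.mk_smul]; congr 1; ext1; simp)
    (fun f g g' => by
      rw [← Submodule.Quotient.mk_add]; congr 1; ext1; simp)
    (fun c f g => by
      rw [← Submodule.Quotient.mk_smul]; congr 1; ext1; simp)

variable (R S) in
/-- The cup product `Hᵖ(S; R) × H^q(S; R) → Hⁿ(S; R)`, `n = p + q`. -/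
def cup {p q n : ℕ} (h : p + q = n) :
    SimplicialCohomology R S p →ₗ[R] SimplicialCohomology R S q →ₗ[R]
      SimplicialCohomology R S n :=
  (Submodule.liftQ _
    (Submodule.liftQ _ (cocycleCup h) (fun f hf => by
      ext g
      exact (Submodule.Quotient.mk_eq_zero _).mpr
        (cochainCup_mem_coboundaries_left h hf g.2))).flip
    (fun g hg => by
      ext f
      exact (Submodule.Quotient.mk_eq_zero _).mpr
        (cochainCup_mem_coboundaries_right h f.2 hg))).flip

theorem cup_mk {p q n : ℕ} (h : p + q = n) (f : cocycles R S p) (g : cocycles R S q) :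
    cup R S h (Submodule.Quotient.mk f) (Submodule.Quotient.mk g) =
      Submodule.Quotient.mk ⟨cochainCup h f g, cochainCup_mem_cocycles h f.2 g.2⟩ := rfl

variable (R S) in
/-- The unit of the cohomology ring, the class of the constant cochain `1`. -/
def cohomologyOne : SimplicialCohomology R S 0 :=
  Submodule.Quotient.mk ⟨fun _ => 1, by
    rw [cocycles, LinearMap.mem_ker]
    ext x
    simp [coboundary, Fin.sum_univ_two]⟩

/-- The map of cochains induced by a map of simplicial sets. -/
def cochainPullback (θ : S ⟶ T) (p : ℕ) : Cochain R T p →ₗ[R] Cochain R S p :=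
  LinearMap.funLeft R R (θ.app (op ⦋p⦌))

theorem coboundary_cochainPullback (θ : S ⟶ T) (p : ℕ) (f : Cochain R T p) :
    coboundary p (cochainPullback θ p f) = cochainPullback θ (p + 1) (coboundary p f) := by
  ext x
  simp [coboundary, cochainPullback, LinearMap.funLeft_apply, SSet.δ_naturality_apply]

theorem cochainPullback_mem_cocycles (θ : S ⟶ T) (p : ℕ) :
    cocycles R T p ≤ (cocycles R S p).comap (cochainPullback θ p) := by
  intro f hf
  rw [Submodule.mem_comap, cocycles, LinearMap.mem_ker, coboundary_cochainPullback]
  rw [cocycles, LinearMap.mem_ker] at hf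
  rw [hf, map_zero]

theorem cochainPullback_mem_coboundaries (θ : S ⟶ T) (p : ℕ) :
    coboundaries R T p ≤ (coboundaries R S p).comap (cochainPullback θ p) := by
  cases p with
  | zero => exact bot_le
  | succ p =>
    rintro _ ⟨e, rfl⟩
    exact ⟨cochainPullback θ p e, coboundary_cochainPullback θ p e⟩

/-- The map induced in cohomology by a map of simplicial sets. -/
def cohomologyPullback (θ : S ⟶ T) (p : ℕ) :
    SimplicialCohomology R T p →ₗ[R] SimplicialCohomology R S p :=
  Submodule.mapQ _ _ ((cochainPullback θ p).restrict (cochainPullback_mem_cocycles θ p))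
    (fun _ hf => cochainPullback_mem_coboundaries θ p hf)

variable (R) in
/-- A homomorphism of cohomology rings `H^*(S; R) → H^*(T; R)`: an `R`-linear map in every degree
which respects the unit and the cup products. -/
structure CohomologyRingHom (S T : SSet.{0}) where
  toLinearMap : ∀ p, SimplicialCohomology R S p →ₗ[R] SimplicialCohomology R T p
  map_one : toLinearMap 0 (cohomologyOne R S) = cohomologyOne R T
  map_cup : ∀ {p q n : ℕ} (h : p + q = n) (x : SimplicialCohomology R S p)
    (y : SimplicialCohomology R S q),
    toLinearMap n (cup R S h x y) = cup R T h (toLinearMap p x) (toLinearMap q y)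

/-- A ring homomorphism `θ` in cohomology is a split ring epimorphism if it has a right inverse
which is a ring homomorphism too. -/
def CohomologyRingHom.IsSplitEpi (θ : CohomologyRingHom R S T) : Prop :=
  ∃ s : CohomologyRingHom R T S, ∀ p x, θ.toLinearMap p (s.toLinearMap p x) = x

variable (R) in
/-- The ring homomorphism induced in cohomology by a map of simplicial sets. -/
def CohomologyRingHom.pullback (θ : S ⟶ T) : CohomologyRingHom R T S where
  toLinearMap := cohomologyPullback θ
  map_one := rfl
  map_cup {p q n} h x y := by
    induction x using Submodule.Quotient.induction_on with | _ f
    induction y using Submodule.Quotient.induction_on with | _ g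
    refine congrArg Submodule.Quotient.mk (Subtype.ext (funext fun x => ?_))
    simp [cochainCup, cochainPullback, LinearMap.funLeft_apply, frontFace, backFace]

/-- The singular simplicial set of a topological space. -/
def singularSet (X : Type) [TopologicalSpace X] : SSet.{0} :=
  TopCat.toSSet.obj (TopCat.of X)

variable (R) in
/-- The ring homomorphism `f^* : H^*(Y; R) → H^*(X; R)` of singular cohomology rings induced by a
continuous map `f : X → Y`. -/
def singularCohomologyMap {X Y : Type} [TopologicalSpace X] [TopologicalSpace Y] (f : C(X, Y)) :
    CohomologyRingHom R (singularSet Y) (singularSet X) :=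
  CohomologyRingHom.pullback R (TopCat.toSSet.map (TopCat.ofHom f))

end Cohomology

end

/-!
Write `P = {ℓ j ≥ 0}` with one affine function `ℓ j` for each facet. Choose a point `b τ` in the
relative interior of the face cut out by `τ`, for every simplex `τ` of the nerve and for `τ = ∅`.
Averaging `b` over the superlevel sets of `u` is a homeomorphism from the cubical complex of the
nerve onto `P` which carries `u` to a point of the facet `j` exactly when `u j = 1`. With the polar
coordinates `z j = t j * (1 - u j)` it becomes a homeomorphism from the moment-angle manifold of
`P` to the moment-angle-complex of its nerve.

This homeomorphism places a face `F = {ℓ i = 0 for i ∈ σ}` over the coordinates `z i = 0`, whereas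
in the image of the moment-angle-complex of `K_F` we have `z i = 1`. To correct this, choose the
points `b τ` with `ℓ i (b τ) = δ` whenever `i ∈ σ`, `i ∉ τ` and `τ ∪ σ` is a simplex. Near `F` we
then have `ℓ i = δ * (1 - u i)`, so a homeomorphism of the unit disc which moves the centre to `1/2`
and fixes the boundary moves `F` to the parallel slice `{ℓ i = δ / 2 for i ∈ σ}`. In the coordinates
of a second choice of points, normalized at the level `δ / 2`, this slice is the image of the
cubical complex of the link of `σ`; by flagness the latter consists of all `u` with `u j = 0` for
`j` outside the vertices of the link, which is the condition `z j = 1`.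
-/

noncomputable section

section LayerIntegral

open MeasureTheory Set Filter Topology

variable {V E : Type*} [Finite V]

/-- The superlevel set `{i | t ≤ u i}` as a finite set. -/
def superlevel (u : V → ℝ) (t : ℝ) : Finset V :=
  (toFinite {i | t ≤ u i}).toFinset

@[simp]
theorem mem_superlevel {u : V → ℝ} {t : ℝ} {i : V} : i ∈ superlevel u t ↔ t ≤ u i := by
  simp [superlevel]

theorem exists_norm_le_of_finite {ι : Type*} [Finite ι] [Norm E] (b : ι → E) :
    ∃ C, ∀ i, ‖b i‖ ≤ C := by
  obtain ⟨C, hC⟩ := (finite_range fun i => ‖b i‖).bddAbove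
  exact ⟨C, fun i => hC (mem_range_self i)⟩

variable [NormedAddCommGroup E]

theorem stronglyMeasurable_superlevel (b : Finset V → E) (u : V → ℝ) :
    StronglyMeasurable fun t => b (superlevel u t) := by
  let _ : MeasurableSpace (Finset V) := ⊤
  have : DiscreteMeasurableSpace (Finset V) := ⟨fun _ => trivial⟩
  have := Finite.to_countable (α := V)
  refine (StronglyMeasurable.of_discrete (f := b)).comp_measurable ?_
  refine measurable_to_countable' fun τ => ?_
  have hτ : superlevel u ⁻¹' {τ} = ⋂ i, {t | t ≤ u i ↔ i ∈ τ} := by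
    ext t
    simp [Finset.ext_iff]
  rw [hτ]
  refine MeasurableSet.iInter fun i => ?_
  by_cases hi : i ∈ τ
  · simp only [hi, iff_true]
    exact measurableSet_Iic
  · simp only [hi, iff_false, not_le]
    exact measurableSet_Ioi

theorem intervalIntegrable_superlevel (b : Finset V → E) (u : V → ℝ) (r s : ℝ) :
    IntervalIntegrable (fun t => b (superlevel u t)) volume r s := by
  obtain ⟨C, hC⟩ := exists_norm_le_of_finite b
  exact (intervalIntegrable_const (c := C)).mono_fun
    (stronglyMeasurable_superlevel b u).aestronglyMeasurable
    (Eventually.of_forall fun t => (hC _).trans (le_abs_self C))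

theorem eventually_superlevel_eq {u : V → ℝ} {t : ℝ} (ht : t ∉ range u) :
    ∀ᶠ v in 𝓝 u, superlevel v t = superlevel u t := by
  have h : ∀ i, ∀ᶠ v in 𝓝 u, (t ≤ v i ↔ t ≤ u i) := by
    intro i
    have hc : ContinuousAt (fun v : V → ℝ => v i) u := continuousAt_apply i u
    rcases lt_or_gt_of_ne (fun h => ht ⟨i, h⟩ : u i ≠ t) with h | h
    · filter_upwards [hc.eventually (gt_mem_nhds h)] with v hv
      exact iff_of_false hv.not_ge h.not_ge
    · filter_upwards [hc.eventually (lt_mem_nhds h)] with v hv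
      exact iff_of_true hv.le h.le
  filter_upwards [eventually_all.mpr h] with v hv
  ext i
  simpa using hv i

variable [NormedSpace ℝ E]

/-- The average over `t ∈ [0, 1]` of the points `b τ`, where `τ` is the superlevel set `{u ≥ t}`.
It is affine on the simplices of the barycentric subdivision of the cube. -/
def layerIntegral (b : Finset V → E) (u : V → ℝ) : E :=
  ∫ t in (0 : ℝ)..1, b (superlevel u t)

theorem continuous_layerIntegral (b : Finset V → E) : Continuous (layerIntegral b) := by
  have := Fintype.ofFinite V
  obtain ⟨C, hC⟩ := exists_norm_le_of_finite b
  refine continuous_iff_continuousAt.mpr fun u => ?_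
  refine intervalIntegral.continuousAt_of_dominated_interval (bound := fun _ => C)
    (Eventually.of_forall fun v => (stronglyMeasurable_superlevel b v).aestronglyMeasurable)
    (Eventually.of_forall fun v => Eventually.of_forall fun t _ => hC _)
    intervalIntegrable_const ?_
  filter_upwards [compl_mem_ae_iff.mpr ((finite_range u).measure_zero volume)] with t ht _
  exact continuousAt_const.congr
    ((eventually_superlevel_eq ht).mono fun v hv => congrArg b hv.symm)

theorem layerIntegral_const [CompleteSpace E] (x : E) (u : V → ℝ) :
    layerIntegral (fun _ => x) u = x := by
  simp [layerIntegral]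

theorem layerIntegral_congr {b b' : Finset V → E} {u : V → ℝ}
    (h : ∀ t ∈ Ioc (0 : ℝ) 1, b (superlevel u t) = b' (superlevel u t)) :
    layerIntegral b u = layerIntegral b' u :=
  intervalIntegral.integral_congr_Ioo_of_le zero_le_one fun t ht => h t (Ioo_subset_Ioc_self ht)

theorem layerIntegral_mono {b b' : Finset V → ℝ} {u : V → ℝ}
    (h : ∀ t ∈ Ioc (0 : ℝ) 1, b (superlevel u t) ≤ b' (superlevel u t)) :
    layerIntegral b u ≤ layerIntegral b' u :=
  intervalIntegral.integral_mono_on_of_le_Ioo zero_le_one (intervalIntegrable_superlevel b u 0 1)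
    (intervalIntegrable_superlevel b' u 0 1) fun t ht => h t (Ioo_subset_Ioc_self ht)

theorem map_layerIntegral [CompleteSpace E] (ℓ : E →ᴬ[ℝ] ℝ) (b : Finset V → E) (u : V → ℝ) :
    ℓ (layerIntegral b u) = layerIntegral (fun τ => ℓ (b τ)) u := by
  rw [ℓ.decomp]
  simp only [layerIntegral, Pi.add_apply, Function.const_apply]
  rw [intervalIntegral.integral_add ?_ intervalIntegrable_const,
    ℓ.contLinear.intervalIntegral_comp_comm (intervalIntegrable_superlevel b u 0 1)]
  · simp
  · exact intervalIntegrable_superlevel (fun τ => ℓ.contLinear (b τ)) u 0 1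

theorem superlevel_lineMap_of_lt {τ : Finset V} {v : V → ℝ} (hτ : ∀ i ∈ τ, v i = 1) (hv : v ≤ 1)
    {s t : ℝ} (hs : 0 ≤ s) (ht : t ∈ Ioc s 1) :
    superlevel (AffineMap.lineMap ((τ : Set V).indicator 1) v s) t = τ := by
  ext i
  by_cases hi : i ∈ τ
  · simp [AffineMap.lineMap_apply_module', hi, hτ i hi, ht.2]
  · have hi1 : v i ≤ 1 := hv i
    simp only [AffineMap.lineMap_apply_module', mem_superlevel, Pi.add_apply, Pi.smul_apply,
      Pi.sub_apply, Finset.mem_coe, hi, not_false_eq_true, indicator_of_notMem, sub_zero,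
      smul_eq_mul, add_zero, iff_false, not_le]
    nlinarith [ht.1]

theorem superlevel_lineMap_of_le {τ : Finset V} {v : V → ℝ} (hτ : ∀ i ∈ τ, v i = 1)
    {s t : ℝ} (hs : s ≤ 1) (ht : t ∈ Ioc 0 s) :
    superlevel (AffineMap.lineMap ((τ : Set V).indicator 1) v s) t = superlevel v (t / s) := by
  have h0 : 0 < s := ht.1.trans_le ht.2
  ext i
  by_cases hi : i ∈ τ
  · simp [AffineMap.lineMap_apply_module', hi, hτ i hi, ht.2.trans hs, div_le_one h0, ht.2]
  · simp [AffineMap.lineMap_apply_module', hi, div_le_iff₀' h0]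

theorem layerIntegral_lineMap [CompleteSpace E] (b : Finset V → E) {τ : Finset V} {v : V → ℝ}
    (hτ : ∀ i ∈ τ, v i = 1) (hv : v ≤ 1) {s : ℝ} (hs : s ∈ Icc (0 : ℝ) 1) :
    layerIntegral b (AffineMap.lineMap ((τ : Set V).indicator 1) v s) =
      AffineMap.lineMap (b τ) (layerIntegral b v) s := by
  set w : V → ℝ := AffineMap.lineMap ((τ : Set V).indicator 1) v s
  have hleft : ∫ t in 0..s, b (superlevel w t) = s • layerIntegral b v := by
    rcases hs.1.eq_or_lt with rfl | h0
    · simp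
    rw [intervalIntegral.integral_congr_Ioo_of_le (g := fun t => b (superlevel v (t / s))) hs.1
      fun t ht => congrArg b (superlevel_lineMap_of_le hτ hs.2 (Ioo_subset_Ioc_self ht)),
      intervalIntegral.integral_comp_div (fun t => b (superlevel v t)) h0.ne', zero_div,
      div_self h0.ne', layerIntegral]
  have hright : ∫ t in s..1, b (superlevel w t) = (1 - s) • b τ := by
    rw [intervalIntegral.integral_congr_Ioo_of_le (g := fun _ => b τ) hs.2
      fun t ht => congrArg b (superlevel_lineMap_of_lt hτ hv hs.1 (Ioo_subset_Ioc_self ht)),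
      intervalIntegral.integral_const]
  rw [layerIntegral, ← intervalIntegral.integral_add_adjacent_intervals
    (intervalIntegrable_superlevel b w 0 s) (intervalIntegrable_superlevel b w s 1), hleft, hright,
    AffineMap.lineMap_apply_module, add_comm]

theorem layerIntegral_indicator [CompleteSpace E] (b : Finset V → E) (τ : Finset V) :
    layerIntegral b ((τ : Set V).indicator 1) = b τ := by
  simpa using layerIntegral_lineMap b (v := 1) (τ := τ) (fun _ _ => rfl) le_rfl
    (left_mem_Icc.mpr zero_le_one)

theorem layerIntegral_eq_mul_one_sub {b : Finset V → ℝ} {u : V → ℝ} {i : V} {δ : ℝ}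
    (hu : u i ∈ Icc (0 : ℝ) 1)
    (h : ∀ t ∈ Ioc (0 : ℝ) 1, b (superlevel u t) = if t ≤ u i then 0 else δ) :
    layerIntegral b u = δ * (1 - u i) := by
  have hleft : ∫ t in 0..u i, b (superlevel u t) = 0 := by
    rw [intervalIntegral.integral_congr_Ioo_of_le (g := fun _ => 0) hu.1 fun t ht =>
      (h t ⟨ht.1, ht.2.le.trans hu.2⟩).trans (if_pos ht.2.le), intervalIntegral.integral_zero]
  have hright : ∫ t in u i..1, b (superlevel u t) = (1 - u i) * δ := by
    rw [intervalIntegral.integral_congr_Ioo_of_le (g := fun _ => δ) hu.2 fun t ht =>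
      (h t ⟨hu.1.trans_lt ht.1, ht.2.le⟩).trans (if_neg ht.1.not_ge),
      intervalIntegral.integral_const, smul_eq_mul]
  rw [layerIntegral, ← intervalIntegral.integral_add_adjacent_intervals
    (intervalIntegrable_superlevel b u 0 (u i)) (intervalIntegrable_superlevel b u (u i) 1),
    hleft, hright, zero_add, mul_comm]

theorem mul_one_sub_le_layerIntegral {b : Finset V → ℝ} {u : V → ℝ} {i : V} {δ : ℝ}
    (hu : u i ∈ Icc (0 : ℝ) 1)
    (h : ∀ t ∈ Ioc (0 : ℝ) 1, (if t ≤ u i then 0 else δ) ≤ b (superlevel u t)) :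
    δ * (1 - u i) ≤ layerIntegral b u := by
  classical
  rw [← layerIntegral_eq_mul_one_sub (b := fun τ => if i ∈ τ then 0 else δ) hu (by simp)]
  exact layerIntegral_mono fun t ht => by simpa using h t ht

end LayerIntegral

section Slices

open Set

variable {V E : Type*} [NormedAddCommGroup E] [NormedSpace ℝ E] {ℓ : V → E →ᴬ[ℝ] ℝ}

/-- The points of the polyhedron `{x | ∀ j, 0 ≤ ℓ j x}` at which the affine functions of `σ` take
the value `s`. Its faces are the slices at `s = 0`, and the polyhedron itself is the slice
with `σ = ∅`. -/
def slice (ℓ : V → E →ᴬ[ℝ] ℝ) (σ : Finset V) (s : ℝ) : Set E :=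
  {x | (∀ j, 0 ≤ ℓ j x) ∧ ∀ i ∈ σ, ℓ i x = s}

theorem lineMap_mem_slice {σ : Finset V} {s : ℝ} {x y : E} (hx : x ∈ slice ℓ σ s)
    (hy : y ∈ slice ℓ σ s) {r : ℝ} (h : ∀ j, 0 ≤ ℓ j (AffineMap.lineMap x y r)) :
    AffineMap.lineMap x y r ∈ slice ℓ σ s :=
  ⟨h, fun i hi => by
    rw [ContinuousAffineMap.apply_lineMap, hx.2 i hi, hy.2 i hi, AffineMap.lineMap_same_apply]⟩

theorem convex_slice (σ : Finset V) (s : ℝ) : Convex ℝ (slice ℓ σ s) := by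
  refine convex_iff_segment_subset.mpr fun x hx y hy => ?_
  rw [segment_eq_image_lineMap]
  rintro _ ⟨r, hr, rfl⟩
  refine lineMap_mem_slice hx hy fun j => ?_
  rw [ContinuousAffineMap.apply_lineMap]
  exact (convex_Ici (0 : ℝ)).lineMap_mem (hx.1 j) (hy.1 j) hr

variable [Finite V]

/-- The set of indices of the affine functions `ℓ j` which vanish at `x`. -/
def zeroSet (ℓ : V → E →ᴬ[ℝ] ℝ) (x : E) : Finset V :=
  (toFinite {j | ℓ j x = 0}).toFinset

@[simp]
theorem mem_zeroSet {x : E} {j : V} : j ∈ zeroSet ℓ x ↔ ℓ j x = 0 := by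
  simp [zeroSet]

end Slices

section Barycentric

open Set Filter Topology

variable {V E : Type*}

/-- The points of the unit cube `[0, 1]^V` whose support is contained in a member of `K`. It is the
cubical realization of `K`, often denoted `cc(K)`. -/
def cubicalComplex (K : Set (Finset V)) : Set (V → ℝ) :=
  ⋃ τ ∈ K, Icc 0 ((τ : Set V).indicator 1)

theorem mem_cubicalComplex {K : Set (Finset V)} {u : V → ℝ} :
    u ∈ cubicalComplex K ↔ ∃ τ ∈ K, u ∈ Icc 0 ((τ : Set V).indicator 1) := by
  simp only [cubicalComplex, mem_iUnion, exists_prop]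

theorem cubicalComplex_subset_Icc (K : Set (Finset V)) : cubicalComplex K ⊆ Icc 0 1 :=
  iUnion₂_subset fun τ _ => Icc_subset_Icc_right
    (indicator_le_self' (s := (τ : Set V)) fun _ _ => zero_le_one)

theorem indicator_mem_cubicalComplex {K : Set (Finset V)} {τ : Finset V} (hτ : τ ∈ K) :
    (τ : Set V).indicator 1 ∈ cubicalComplex K :=
  mem_cubicalComplex.mpr ⟨τ, hτ, indicator_nonneg fun _ _ => zero_le_one, le_rfl⟩

theorem eq_zero_of_le_indicator {τ : Finset V} {u : V → ℝ}
    (hu : u ∈ Icc 0 ((τ : Set V).indicator 1)) {i : V} (hi : i ∉ τ) : u i = 0 :=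
  le_antisymm (by simpa [hi] using hu.2 i) (hu.1 i)

variable [Finite V]

theorem isCompact_cubicalComplex (K : Set (Finset V)) : IsCompact (cubicalComplex K) :=
  (toFinite K).isCompact_biUnion fun _ _ => isCompact_Icc

theorem superlevel_subset_of_le_indicator {τ : Finset V} {u : V → ℝ}
    (hu : u ∈ Icc 0 ((τ : Set V).indicator 1)) {t : ℝ} (ht : 0 < t) : superlevel u t ⊆ τ := by
  intro i hi
  by_contra h
  rw [mem_superlevel, eq_zero_of_le_indicator hu h] at hi
  exact ht.not_ge hi

theorem superlevel_mem {K : Set (Finset V)} (hK : IsLowerSet K) {u : V → ℝ}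
    (hu : u ∈ cubicalComplex K) {t : ℝ} (ht : 0 < t) : superlevel u t ∈ K := by
  obtain ⟨τ, hτ, h⟩ := mem_cubicalComplex.mp hu
  exact hK (superlevel_subset_of_le_indicator h ht) hτ

theorem superlevel_one_eq_one {u : V → ℝ} (hu : u ≤ 1) {i : V} (hi : i ∈ superlevel u 1) :
    u i = 1 :=
  (hu i).antisymm (mem_superlevel.mp hi)

theorem indicator_superlevel_one_le {u : V → ℝ} (hu : 0 ≤ u) :
    (superlevel u 1 : Set V).indicator 1 ≤ u :=
  indicator_le' (fun _ hi => mem_superlevel.mp hi) fun i _ => hu i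

theorem exists_eq_lineMap_indicator {K : Set (Finset V)} {u : V → ℝ} (hu : u ∈ cubicalComplex K) :
    ∃ s ∈ Ico (0 : ℝ) 1, ∃ v ∈ cubicalComplex K, superlevel u 1 ⊆ superlevel v 1 ∧
      (0 < s → superlevel u 1 ≠ superlevel v 1) ∧
      u = AffineMap.lineMap ((superlevel u 1 : Set V).indicator 1) v s := by
  set τ := superlevel u 1 with hτ
  have hu0 : 0 ≤ u := (cubicalComplex_subset_Icc K hu).1
  by_cases hle : u ≤ (τ : Set V).indicator 1
  · exact ⟨0, by simp, u, hu, hτ.le, by simp, by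
      simpa using hle.antisymm (indicator_superlevel_one_le hu0)⟩
  obtain ⟨i, hi⟩ : ∃ i, (τ : Set V).indicator 1 i < u i := by simpa [Pi.le_def] using hle
  have hiτ : i ∉ τ := fun h => hi.not_ge (by
    simpa [h] using (cubicalComplex_subset_Icc K hu).2 i)
  obtain ⟨j, hj, hmax⟩ := exists_max_image {j | j ∉ τ} u (toFinite _) ⟨i, hiτ⟩
  have hj0 : 0 < u j := lt_of_lt_of_le (by simpa [hiτ] using hi) (hmax i hiτ)
  -- The ray from the vertex `τ` of the cube through `u` leaves the cube at `v`.
  set v : V → ℝ := AffineMap.lineMap ((τ : Set V).indicator 1) u (u j)⁻¹ with hv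
  have hv_mem : ∀ i ∈ τ, v i = 1 := fun i hi => by
    have := superlevel_one_eq_one (cubicalComplex_subset_Icc K hu).2 hi
    simp [hv, AffineMap.lineMap_apply_module', hi, this]
  have hv_notMem : ∀ i ∉ τ, v i = (u j)⁻¹ * u i := fun i hi => by
    simp [hv, AffineMap.lineMap_apply_module', hi]
  have hjv : v j = 1 := by rw [hv_notMem j hj, inv_mul_cancel₀ hj0.ne']
  refine ⟨u j, ⟨hj0.le, by simpa [hτ] using hj⟩, v, ?_, fun i hi => ?_, fun _ h => hj ?_, ?_⟩
  · obtain ⟨ρ, hρ, huρ⟩ := mem_cubicalComplex.mp hu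
    refine mem_cubicalComplex.mpr ⟨ρ, hρ, fun i => ?_, le_indicator (fun i _ => ?_) fun i hi => ?_⟩
    · by_cases hi : i ∈ τ
      · simp [hv_mem i hi]
      · rw [hv_notMem i hi]
        exact mul_nonneg (inv_nonneg.mpr hj0.le) (hu0 i)
    · by_cases hi : i ∈ τ
      · simp [hv_mem i hi]
      · rw [hv_notMem i hi, Pi.one_apply, inv_mul_le_one₀ hj0]
        exact hmax i hi
    · have h0 := eq_zero_of_le_indicator huρ hi
      rw [hv_notMem i fun h => by simp [hτ, h0, zero_lt_one.not_ge] at h, h0, mul_zero]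
  · simp [hv_mem i hi]
  · simp [h, hjv]
  · rw [hv, AffineMap.lineMap_lineMap_right, mul_inv_cancel₀ hj0.ne', AffineMap.lineMap_apply_one]

variable [NormedAddCommGroup E] [NormedSpace ℝ E] {ℓ : V → E →ᴬ[ℝ] ℝ}

/-- The slice is compact, the family `K` contains the sets of inequalities which are sharp at some
point of the slice, and for `τ ∈ K` exactly the inequalities of `τ` are sharp at the point `b τ` of
the slice, which thus plays the role of a barycentre of the corresponding face. -/
structure IsBarycentricSystem (ℓ : V → E →ᴬ[ℝ] ℝ) (σ : Finset V) (s : ℝ) (K : Set (Finset V))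
    (b : Finset V → E) : Prop where
  isCompact : IsCompact (slice ℓ σ s)
  zeroSet_mem : ∀ x ∈ slice ℓ σ s, zeroSet ℓ x ∈ K
  isLowerSet : IsLowerSet K
  mem : ∀ τ ∈ K, b τ ∈ slice ℓ σ s
  zeroSet_eq : ∀ τ ∈ K, zeroSet ℓ (b τ) = τ

namespace IsBarycentricSystem

variable {σ : Finset V} {s : ℝ} {K : Set (Finset V)} {b : Finset V → E}

theorem zeroSet_subset_of_lineMap_eq (h : IsBarycentricSystem ℓ σ s K b) {τ : Finset V}
    (hτ : τ ∈ K) {x y : E} (hx : x ∈ slice ℓ σ s) {p q : ℝ} (hp : 0 ≤ p) (hpq : p < q)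
    (hxy : AffineMap.lineMap (b τ) x p = AffineMap.lineMap (b τ) y q) : zeroSet ℓ y ⊆ τ := by
  intro j hj
  rw [← h.zeroSet_eq τ hτ, mem_zeroSet]
  have key : (1 - p) * ℓ j (b τ) + p * ℓ j x = (1 - q) * ℓ j (b τ) := by
    have := congrArg (ℓ j) hxy
    simpa only [ContinuousAffineMap.apply_lineMap, AffineMap.lineMap_apply_ring,
      mem_zeroSet.mp hj, mul_zero, add_zero] using this
  have h1 := (h.mem τ hτ).1 j
  nlinarith [mul_nonneg hp (hx.1 j)]

theorem exists_exit (h : IsBarycentricSystem ℓ σ s K b) {τ : Finset V} (hτ : τ ∈ K) {x : E}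
    (hx : x ∈ slice ℓ σ s) (hτx : τ ⊆ zeroSet ℓ x) (hne : b τ ≠ x) :
    ∃ y ∈ slice ℓ σ s, τ ⊂ zeroSet ℓ y ∧
      ∃ r ∈ Icc (0 : ℝ) 1, x = AffineMap.lineMap (b τ) y r := by
  have hγ : Continuous (AffineMap.lineMap (b τ) x : ℝ → E) := AffineMap.lineMap_continuous
  have hcompact : IsCompact ((AffineMap.lineMap (b τ) x : ℝ → E) ⁻¹' slice ℓ σ s) :=
    Metric.isCompact_of_isClosed_isBounded (h.isCompact.isClosed.preimage hγ)
      ((antilipschitzWith_lineMap hne).isBounded_preimage h.isCompact.isBounded)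
  have h1 : (1 : ℝ) ∈ (AffineMap.lineMap (b τ) x : ℝ → E) ⁻¹' slice ℓ σ s := by simpa using hx
  obtain ⟨r, hr, hmax⟩ := hcompact.exists_isGreatest ⟨1, h1⟩
  have hr1 : 1 ≤ r := hmax h1
  have hzero : ∀ q : ℝ, ∀ j ∈ τ, ℓ j (AffineMap.lineMap (b τ) x q) = 0 := by
    intro q j hj
    have hb : ℓ j (b τ) = 0 := mem_zeroSet.mp (by rwa [h.zeroSet_eq τ hτ])
    rw [ContinuousAffineMap.apply_lineMap, hb, mem_zeroSet.mp (hτx hj),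
      AffineMap.lineMap_same_apply]
  refine ⟨_, hr, ⟨fun j hj => mem_zeroSet.mpr (hzero r j hj), fun hsub => ?_⟩, r⁻¹,
    ⟨by positivity, inv_le_one_of_one_le₀ hr1⟩, ?_⟩
  · have hev : ∀ᶠ q in 𝓝 r, ∀ j, 0 ≤ ℓ j (AffineMap.lineMap (b τ) x q) := by
      refine eventually_all.mpr fun j => ?_
      by_cases hj : j ∈ τ
      · exact Eventually.of_forall fun q => (hzero q j hj).ge
      · have hpos : 0 < ℓ j (AffineMap.lineMap (b τ) x r) :=
          (hr.1 j).lt_of_ne fun h0 => hj (hsub (mem_zeroSet.mpr h0.symm))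
        exact (((ℓ j).continuous.comp hγ).continuousAt.eventually (lt_mem_nhds hpos)).mono
          fun _ => le_of_lt
    obtain ⟨q, hrq, hq⟩ := (eventually_mem_nhdsWithin.and
      (hev.filter_mono (nhdsWithin_le_nhds (s := Ioi r)))).exists
    exact (mem_Ioi.mp hrq).not_ge (hmax (lineMap_mem_slice (h.mem τ hτ) hx hq))
  · rw [AffineMap.lineMap_lineMap_right, inv_mul_cancel₀ (by positivity),
      AffineMap.lineMap_apply_one]

theorem eventually_le_of_notMem (h : IsBarycentricSystem ℓ σ s K b) (j : V) :
    ∀ᶠ δ in 𝓝[>] (0 : ℝ), ∀ τ ∈ K, j ∉ τ → δ ≤ ℓ j (b τ) := by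
  refine eventually_all.mpr fun τ => ?_
  by_cases hτ : τ ∈ K ∧ j ∉ τ
  · have hpos : 0 < ℓ j (b τ) := ((h.mem τ hτ.1).1 j).lt_of_ne fun h0 =>
      hτ.2 (by rw [← h.zeroSet_eq τ hτ.1, mem_zeroSet, h0])
    exact ((gt_mem_nhds hpos).filter_mono nhdsWithin_le_nhds).mono fun δ hδ _ _ => hδ.le
  · exact Eventually.of_forall fun δ h1 h2 => absurd ⟨h1, h2⟩ hτ

variable [CompleteSpace E]

theorem layerIntegral_mem (h : IsBarycentricSystem ℓ σ s K b) {u : V → ℝ}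
    (hu : u ∈ cubicalComplex K) : layerIntegral b u ∈ slice ℓ σ s := by
  have hb : ∀ t ∈ Ioc (0 : ℝ) 1, b (superlevel u t) ∈ slice ℓ σ s := fun t ht =>
    h.mem _ (superlevel_mem h.isLowerSet hu ht.1)
  refine ⟨fun j => ?_, fun i hi => ?_⟩
  · rw [map_layerIntegral, ← layerIntegral_const 0 u]
    exact layerIntegral_mono fun t ht => (hb t ht).1 j
  · rw [map_layerIntegral, layerIntegral_congr (b' := fun _ => s) fun t ht => (hb t ht).2 i hi,
      layerIntegral_const]

theorem zeroSet_layerIntegral (h : IsBarycentricSystem ℓ σ s K b) {u : V → ℝ}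
    (hu : u ∈ cubicalComplex K) : zeroSet ℓ (layerIntegral b u) = superlevel u 1 := by
  have hu01 := cubicalComplex_subset_Icc K hu
  have hK : ∀ t ∈ Ioc (0 : ℝ) 1, superlevel u t ∈ K := fun t ht =>
    superlevel_mem h.isLowerSet hu ht.1
  ext j
  rw [mem_zeroSet, mem_superlevel, map_layerIntegral]
  constructor
  · intro h0
    obtain ⟨δ, hδ, hδ0⟩ := ((h.eventually_le_of_notMem j).and self_mem_nhdsWithin).exists
    have key : δ * (1 - u j) ≤ layerIntegral (fun τ => ℓ j (b τ)) u := by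
      refine mul_one_sub_le_layerIntegral ⟨hu01.1 j, hu01.2 j⟩ fun t ht => ?_
      split_ifs with hj
      · exact (h.mem _ (hK t ht)).1 j
      · exact hδ _ (hK t ht) (by simpa using hj)
    exact sub_nonpos.mp (nonpos_of_mul_nonpos_right (key.trans_eq h0) hδ0)
  · intro h1
    rw [layerIntegral_congr (b' := fun _ => 0) fun t ht => ?_, layerIntegral_const]
    · rw [← mem_zeroSet, h.zeroSet_eq _ (hK t ht), mem_superlevel]
      exact ht.2.trans h1

theorem injOn (h : IsBarycentricSystem ℓ σ s K b) :
    InjOn (layerIntegral b) (cubicalComplex K) := by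
  intro u hu v hv huv
  induction hτ : superlevel u 1 using WellFoundedGT.induction generalizing u v with
  | ind τ ih =>
  have hτv : superlevel v 1 = τ := by
    rw [← hτ, ← h.zeroSet_layerIntegral hu, huv, h.zeroSet_layerIntegral hv]
  have hτK : τ ∈ K := hτ ▸ superlevel_mem h.isLowerSet hu one_pos
  obtain ⟨p, hp, u', hu', hτu', hne_u, hup⟩ := exists_eq_lineMap_indicator hu
  obtain ⟨q, hq, v', hv', hτv', hne_v, hvq⟩ := exists_eq_lineMap_indicator hv
  rw [hτ] at hτu' hne_u hup
  rw [hτv] at hτv' hne_v hvq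
  have key : AffineMap.lineMap (b τ) (layerIntegral b u') p =
      AffineMap.lineMap (b τ) (layerIntegral b v') q := by
    have hu'1 := (cubicalComplex_subset_Icc K hu').2
    have hv'1 := (cubicalComplex_subset_Icc K hv').2
    rw [← layerIntegral_lineMap b (fun i hi => superlevel_one_eq_one hu'1 (hτu' hi)) hu'1
        (Ico_subset_Icc_self hp), ← hup, huv, hvq,
      layerIntegral_lineMap b (fun i hi => superlevel_one_eq_one hv'1 (hτv' hi)) hv'1
        (Ico_subset_Icc_self hq)]
  rcases lt_trichotomy p q with hpq | rfl | hqp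
  · refine absurd (hτv'.antisymm ?_) (hne_v (hp.1.trans_lt hpq))
    rw [← h.zeroSet_layerIntegral hv']
    exact h.zeroSet_subset_of_lineMap_eq hτK (h.layerIntegral_mem hu') hp.1 hpq key
  · rcases hp.1.eq_or_lt with rfl | hp0
    · rw [hup, hvq, AffineMap.lineMap_apply_zero, AffineMap.lineMap_apply_zero]
    · have huv' : layerIntegral b u' = layerIntegral b v' := by
        simpa [AffineMap.lineMap_apply_module, hp0.ne'] using key
      rw [hup, hvq, ih (superlevel u' 1) (hτu'.lt_of_ne (hne_u hp0)) hu' hv' huv' rfl]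
  · refine absurd (hτu'.antisymm ?_) (hne_u (hq.1.trans_lt hqp))
    rw [← h.zeroSet_layerIntegral hu']
    exact h.zeroSet_subset_of_lineMap_eq hτK (h.layerIntegral_mem hv') hq.1 hqp key.symm

theorem surjOn (h : IsBarycentricSystem ℓ σ s K b) :
    SurjOn (layerIntegral b) (cubicalComplex K) (slice ℓ σ s) := by
  intro x hx
  induction hτ : zeroSet ℓ x using WellFoundedGT.induction generalizing x with
  | ind τ ih =>
  have hτK : τ ∈ K := hτ ▸ h.zeroSet_mem x hx
  by_cases hne : b τ = x
  · exact ⟨_, indicator_mem_cubicalComplex hτK, (layerIntegral_indicator b τ).trans hne⟩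
  obtain ⟨y, hy, hτy, r, hr, hxy⟩ := h.exists_exit hτK hx hτ.ge hne
  obtain ⟨v, hv, rfl⟩ := ih (zeroSet ℓ y) hτy hy rfl
  rw [h.zeroSet_layerIntegral hv] at hτy
  obtain ⟨ρ, hρ, hvρ⟩ := mem_cubicalComplex.mp hv
  have hv1 := (cubicalComplex_subset_Icc K hv).2
  have hτv : (τ : Set V).indicator 1 ∈ Icc 0 ((ρ : Set V).indicator 1) :=
    ⟨indicator_nonneg fun _ _ => zero_le_one,
      (indicator_le_indicator_of_subset hτy.1 fun _ => zero_le_one).trans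
        ((indicator_superlevel_one_le hvρ.1).trans hvρ.2)⟩
  refine ⟨AffineMap.lineMap ((τ : Set V).indicator 1) v r,
    mem_cubicalComplex.mpr ⟨ρ, hρ, (convex_Icc _ _).lineMap_mem hτv hvρ hr⟩, ?_⟩
  rw [layerIntegral_lineMap b (fun i hi => superlevel_one_eq_one hv1 (hτy.1 hi)) hv1 hr, hxy]

/-- The layer integral as a homeomorphism from the cubical complex onto the slice. -/
def homeomorph (h : IsBarycentricSystem ℓ σ s K b) : cubicalComplex K ≃ₜ slice ℓ σ s :=
  have : CompactSpace (cubicalComplex K) :=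
    isCompact_iff_compactSpace.mp (isCompact_cubicalComplex K)
  ((continuous_layerIntegral b).continuousOn.mapsToRestrict
      fun _ hu => h.layerIntegral_mem hu).homeoOfEquivCompactToT2
    (f := (BijOn.equiv _ ⟨fun _ hu => h.layerIntegral_mem hu, h.injOn, h.surjOn⟩))

end IsBarycentricSystem

end Barycentric

section Polyhedra

open Set Filter Topology

variable {V E : Type*} [NormedAddCommGroup E] [NormedSpace ℝ E] {ℓ : V → E →ᴬ[ℝ] ℝ}

theorem apply_add_smul (f : E →ᴬ[ℝ] ℝ) (x w : E) (r : ℝ) :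
    f (x + r • w) = f x + r * f.contLinear w := by
  rw [add_comm, ← vadd_eq_add, f.map_vadd, map_smul, smul_eq_mul, vadd_eq_add, add_comm]

theorem contLinear_sub (f : E →ᴬ[ℝ] ℝ) (x y : E) : f.contLinear (x - y) = f x - f y := by
  rw [← vsub_eq_sub, f.contLinear_map_vsub, vsub_eq_sub]

theorem contLinear_ne_zero {f : E →ᴬ[ℝ] ℝ} {x y : E} (h : f x ≠ f y) : f.contLinear ≠ 0 := by
  intro h0
  have := contLinear_sub f x y
  rw [h0, zero_apply] at this
  exact h (sub_eq_zero.mp this.symm)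

theorem slice_comp_equiv {W : Type*} (ℓ : V → E →ᴬ[ℝ] ℝ) (e : W ≃ V) (σ : Finset W) (s : ℝ) :
    slice (fun j => ℓ (e j)) σ s = slice ℓ (σ.map e.toEmbedding) s := by
  ext x
  simp [slice, e.surjective.forall]

theorem slice_anti {σ τ : Finset V} (h : σ ⊆ τ) (s : ℝ) : slice ℓ τ s ⊆ slice ℓ σ s :=
  fun _ hx => ⟨hx.1, fun j hj => hx.2 j (h hj)⟩

theorem isClosed_slice (ℓ : V → E →ᴬ[ℝ] ℝ) (σ : Finset V) (s : ℝ) : IsClosed (slice ℓ σ s) := by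
  simp only [slice, ofPred_and, ofPred_forall]
  exact (isClosed_iInter fun j => isClosed_le continuous_const (ℓ j).continuous).inter
    (isClosed_biInter fun j _ => isClosed_eq (ℓ j).continuous continuous_const)

theorem isExposed_slice {σ τ : Finset V} (h : σ ⊆ τ) :
    IsExposed ℝ (slice ℓ σ 0) (slice ℓ τ 0) := by
  rintro ⟨x₀, hx₀⟩
  refine ⟨-∑ j ∈ τ, (ℓ j).contLinear, ?_⟩
  have hle : ∀ x y, (-∑ j ∈ τ, (ℓ j).contLinear) y ≤ (-∑ j ∈ τ, (ℓ j).contLinear) x ↔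
      ∑ j ∈ τ, ℓ j x ≤ ∑ j ∈ τ, ℓ j y := fun x y => by
    simp only [neg_apply, sum_apply, neg_le_neg_iff]
    rw [← sub_nonneg, ← Finset.sum_sub_distrib, ← sub_nonneg (b := ∑ j ∈ τ, ℓ j x),
      ← Finset.sum_sub_distrib]
    simp only [← map_sub, contLinear_sub]
  ext x
  simp only [mem_ofPred_eq, hle]
  refine ⟨fun hx => ⟨slice_anti h 0 hx, fun y hy => ?_⟩, fun ⟨hx, hmax⟩ => ⟨hx.1, ?_⟩⟩
  · rw [Finset.sum_eq_zero hx.2]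
    exact Finset.sum_nonneg fun j _ => hy.1 j
  · have hsum := hmax x₀ (slice_anti h 0 hx₀)
    rw [Finset.sum_eq_zero hx₀.2] at hsum
    exact (Finset.sum_eq_zero_iff_of_nonneg fun j _ => hx.1 j).mp
      (hsum.antisymm (Finset.sum_nonneg fun j _ => hx.1 j))

theorem vectorSpan_eq_of_eventually_mem {G : Set E} {W : Submodule ℝ E} {y : E} (hy : y ∈ G)
    (hG : ∀ x ∈ G, x - y ∈ W) (hW : ∀ w ∈ W, ∀ᶠ r : ℝ in 𝓝 0, y + r • w ∈ G) :
    vectorSpan ℝ G = W := by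
  apply le_antisymm
  · rw [vectorSpan_eq_span_vsub_set_right ℝ hy, Submodule.span_le]
    rintro _ ⟨x, hx, rfl⟩
    exact hG x hx
  · intro w hw
    obtain ⟨r, hrw, hr⟩ :=
      (((hW w hw).filter_mono nhdsWithin_le_nhds).and self_mem_nhdsWithin : ∀ᶠ r in 𝓝[≠] (0 : ℝ),
        y + r • w ∈ G ∧ r ≠ 0).exists
    have h := vsub_mem_vectorSpan ℝ hrw hy
    rw [vsub_eq_sub, add_sub_cancel_left] at h
    exact (Submodule.smul_mem_iff _ hr).mp h

variable [Finite V]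

theorem eventually_pos_of_notMem_zeroSet {x : E} (hx : ∀ j, 0 ≤ ℓ j x) (w : E) :
    ∀ᶠ r : ℝ in 𝓝 0, ∀ j ∉ zeroSet ℓ x, 0 < ℓ j (x + r • w) := by
  refine eventually_all.mpr fun j => ?_
  by_cases hj : j ∈ zeroSet ℓ x
  · exact Eventually.of_forall fun r h => absurd hj h
  · have hc : Continuous fun r : ℝ => ℓ j (x + r • w) := by fun_prop
    have hpos : 0 < ℓ j (x + (0 : ℝ) • w) := by
      rw [zero_smul, add_zero]
      exact (hx j).lt_of_ne' (mt mem_zeroSet.mpr hj)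
    exact (hc.continuousAt.eventually (lt_mem_nhds hpos)).mono fun r hr _ => hr

theorem eventually_add_smul_mem_slice {x w : E} (hx : ∀ j, 0 ≤ ℓ j x)
    (hw : ∀ j ∈ zeroSet ℓ x, (ℓ j).contLinear w = 0) :
    ∀ᶠ r : ℝ in 𝓝 0, x + r • w ∈ slice ℓ (zeroSet ℓ x) 0 := by
  filter_upwards [eventually_pos_of_notMem_zeroSet hx w] with r hr
  have hzero : ∀ j ∈ zeroSet ℓ x, ℓ j (x + r • w) = 0 := fun j hj => by
    rw [apply_add_smul, hw j hj, mem_zeroSet.mp hj, mul_zero, add_zero]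
  refine ⟨fun j => ?_, hzero⟩
  by_cases hj : j ∈ zeroSet ℓ x
  · exact (hzero j hj).ge
  · exact (hr j hj).le

theorem vectorSpan_slice_zeroSet {x : E} (hx : ∀ j, 0 ≤ ℓ j x) :
    vectorSpan ℝ (slice ℓ (zeroSet ℓ x) 0) =
      ⨅ j ∈ zeroSet ℓ x, ((ℓ j).contLinear : E →ₗ[ℝ] ℝ).ker := by
  refine vectorSpan_eq_of_eventually_mem (y := x) ⟨hx, fun j => mem_zeroSet.mp⟩ (fun y hy => ?_)
    fun w hw => eventually_add_smul_mem_slice hx (by simpa [Submodule.mem_iInf] using hw)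
  simp only [Submodule.mem_iInf, LinearMap.mem_ker, ContinuousLinearMap.coe_coe, contLinear_sub]
  intro j hj
  rw [hy.2 j hj, mem_zeroSet.mp hj, sub_zero]

theorem exists_zeroSet_minimal {G : Set E} (hG : Convex ℝ G) (hne : G.Nonempty)
    (hnn : ∀ x ∈ G, ∀ j, 0 ≤ ℓ j x) : ∃ z ∈ G, ∀ x ∈ G, zeroSet ℓ z ⊆ zeroSet ℓ x := by
  obtain ⟨z, hz, hmin⟩ := exists_minimalFor_of_wellFoundedLT (· ∈ G) (zeroSet ℓ) hne
  refine ⟨z, hz, fun x hx => ?_⟩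
  have hmid : ∀ j ∈ zeroSet ℓ (midpoint ℝ z x), j ∈ zeroSet ℓ z ∧ j ∈ zeroSet ℓ x := fun j hj => by
    rw [mem_zeroSet, midpoint, ContinuousAffineMap.apply_lineMap, AffineMap.lineMap_apply_ring,
      invOf_eq_inv] at hj
    rw [mem_zeroSet, mem_zeroSet]
    have := hnn z hz j
    have := hnn x hx j
    constructor <;> linarith
  exact fun j hj => (hmid j (hmin (hG.midpoint_mem hz hx) (fun i hi => (hmid i hi).1) hj)).2

theorem eq_zero_of_mem_extremePoints {v w : E} (hv : v ∈ (slice ℓ ∅ 0).extremePoints ℝ)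
    (hw : ∀ j ∈ zeroSet ℓ v, (ℓ j).contLinear w = 0) : w = 0 := by
  have hmem : ∀ᶠ r : ℝ in 𝓝 0, v + r • w ∈ slice ℓ ∅ 0 :=
    (eventually_add_smul_mem_slice hv.1.1 hw).mono fun r => (slice_anti (Finset.empty_subset _) 0 ·)
  have hneg : ∀ᶠ r : ℝ in 𝓝 0, v + (-r) • w ∈ slice ℓ ∅ 0 :=
    (continuous_neg.tendsto' (0 : ℝ) 0 neg_zero).eventually hmem
  obtain ⟨r, ⟨h₁, h₂⟩, hr⟩ := ((hmem.and hneg).filter_mono nhdsWithin_le_nhds |>.and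
    self_mem_nhdsWithin : ∀ᶠ r in 𝓝[≠] (0 : ℝ), _ ∧ r ≠ 0).exists
  rw [neg_smul, ← sub_eq_add_neg] at h₂
  have := hv.2 h₁ h₂ (mem_openSegment_add_sub v (r • w))
  exact (smul_eq_zero.mp (by simpa using this)).resolve_left hr

end Polyhedra

section Faces

open Set Filter Topology

variable {V : Type*} {E : Type} [Finite V] [NormedAddCommGroup E] [NormedSpace ℝ E]
  {ℓ : V → E →ᴬ[ℝ] ℝ}

theorem exists_eq_slice_zeroSet {σ : Finset V} {G : Set E} (hG : IsFace (slice ℓ σ 0) G) :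
    ∃ z ∈ G, G = slice ℓ (zeroSet ℓ z) 0 := by
  obtain ⟨hne, hexp⟩ := hG
  obtain ⟨l, hl⟩ := hexp hne
  obtain ⟨z, hz, hmin⟩ := exists_zeroSet_minimal (ℓ := ℓ) (hexp.convex (convex_slice σ 0)) hne
    fun x hx => (hexp.subset hx).1
  have hzσ := hexp.subset hz
  have hσz : σ ⊆ zeroSet ℓ z := fun j hj => mem_zeroSet.mpr (hzσ.2 j hj)
  refine ⟨z, hz, Subset.antisymm
    (fun x hx => ⟨(hexp.subset hx).1, fun j hj => mem_zeroSet.mp (hmin x hx hj)⟩) fun x hx => ?_⟩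
  -- The segment from `x` to `z` extends beyond `z` in the polyhedron, and `l` is maximal at `z`.
  obtain ⟨r, hy, hr⟩ := ((eventually_add_smul_mem_slice hzσ.1 (w := z - x) fun j hj => by
    rw [contLinear_sub, hx.2 j hj, mem_zeroSet.mp hj, sub_zero]).filter_mono nhdsWithin_le_nhds
      |>.and self_mem_nhdsWithin : ∀ᶠ r in 𝓝[>] (0 : ℝ), _ ∧ 0 < r).exists
  rw [hl] at hz ⊢
  have hle := hz.2 _ (slice_anti hσz 0 hy)
  rw [map_add, map_smul, map_sub, smul_eq_mul, add_le_iff_nonpos_right] at hle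
  exact ⟨slice_anti hσz 0 hx, fun y hy => (hz.2 y hy).trans
    (sub_nonpos.mp (nonpos_of_mul_nonpos_right hle hr))⟩

end Faces

section Irredundant

open Set Filter Topology

theorem exists_irredundant {ι X : Type*} [Finite ι] (S : ι → Set X) :
    ∃ I : Set ι, ⋂ i, S i = ⋂ i : I, S i ∧ ∀ i ∈ I, ∃ x ∉ S i, ∀ j ∈ I, j ≠ i → x ∈ S j := by
  obtain ⟨I, hI, hmin⟩ := exists_minimal_of_wellFoundedLT
    (fun I : Set ι => ⋂ i, S i = ⋂ i : I, S i) ⟨univ, by simp⟩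
  refine ⟨I, hI, fun i hi => ?_⟩
  by_contra! h
  have hdiff : ⋂ i, S i = ⋂ j : (I \ {i} : Set ι), S j := by
    rw [hI]
    ext x
    simp only [mem_iInter, Subtype.forall]
    refine ⟨fun hx j hj => hx j hj.1, fun hx j hj => ?_⟩
    by_contra hxj
    obtain rfl : j = i := by_contra fun hji => hxj (hx j ⟨hj, hji⟩)
    obtain ⟨k, hk, hkj, hxk⟩ := h x hxj
    exact hxk (hx k ⟨hk, hkj⟩)
  exact (hmin hdiff sdiff_subset hi).2 rfl

variable {E : Type*} [NormedAddCommGroup E] [NormedSpace ℝ E]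

theorem pos_of_mem_interior {f : E →ᴬ[ℝ] ℝ} {p x : E} (hp : p ∈ interior {y | 0 ≤ f y})
    (hx : f x < 0) : 0 < f p := by
  have hp0 : p ∈ {y | 0 ≤ f y} := interior_subset hp
  refine hp0.lt_of_ne' fun h0 => ?_
  have hc : Continuous fun r : ℝ => AffineMap.lineMap p x r := by fun_prop
  have hnn : ∀ᶠ r : ℝ in 𝓝 0, 0 ≤ f (AffineMap.lineMap p x r) :=
    (hc.tendsto' 0 p (AffineMap.lineMap_apply_zero p x)).eventually
      (mem_interior_iff_mem_nhds.mp hp)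
  obtain ⟨r, hr, hr0⟩ := ((hnn.filter_mono nhdsWithin_le_nhds).and self_mem_nhdsWithin :
    ∀ᶠ r in 𝓝[>] (0 : ℝ), _ ∧ 0 < r).exists
  rw [ContinuousAffineMap.apply_lineMap, AffineMap.lineMap_apply_ring, h0, mul_zero, zero_add] at hr
  exact (mul_neg_of_pos_of_neg hr0 hx).not_ge hr

theorem setDim_of_interior_nonempty {E : Type} [NormedAddCommGroup E] [NormedSpace ℝ E] {P : Set E}
    (h : (interior P).Nonempty) : setDim P = Module.finrank ℝ E := by
  have hspan : affineSpan ℝ P = ⊤ := affineSpan_eq_top_of_nonempty_interior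
    (h.mono (interior_mono (subset_convexHull ℝ P)))
  rw [setDim, ← direction_affineSpan, hspan, AffineSubspace.direction_top, finrank_top]

variable {V : Type*} [Finite V] {ℓ : V → E →ᴬ[ℝ] ℝ}

theorem exists_zeroSet_eq_singleton {p x : E} {i : V} (hp : ∀ j, 0 < ℓ j p) (hx : ℓ i x < 0)
    (hxj : ∀ j, j ≠ i → 0 ≤ ℓ j x) : ∃ y, (∀ j, 0 ≤ ℓ j y) ∧ zeroSet ℓ y = {i} := by
  have hc : ContinuousOn (fun r : ℝ => ℓ i (AffineMap.lineMap x p r)) (Icc 0 1) := by fun_prop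
  obtain ⟨r, ⟨hr0, hr1⟩, hr⟩ := intermediate_value_Icc zero_le_one hc (show (0 : ℝ) ∈ Icc _ _ by
    simpa using ⟨hx.le, (hp i).le⟩)
  have hr0' : 0 < r := hr0.lt_of_ne (by
    rintro rfl
    simp only [AffineMap.lineMap_apply_zero] at hr
    exact hx.ne hr)
  have hpos : ∀ j, j ≠ i → 0 < ℓ j (AffineMap.lineMap x p r) := fun j hj => by
    rw [ContinuousAffineMap.apply_lineMap, AffineMap.lineMap_apply_ring]
    exact add_pos_of_nonneg_of_pos (mul_nonneg (sub_nonneg.mpr hr1) (hxj j hj))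
      (mul_pos hr0' (hp j))
  refine ⟨AffineMap.lineMap x p r, fun j => ?_, ?_⟩
  · rcases eq_or_ne j i with rfl | hj
    exacts [hr.ge, (hpos j hj).le]
  · ext j
    rw [mem_zeroSet, Finset.mem_singleton]
    refine ⟨fun h => by_contra fun hj => (hpos j hj).ne' h, ?_⟩
    rintro rfl
    exact hr

end Irredundant

section Facets

open Set

variable {V : Type*} {E : Type} [Finite V] [NormedAddCommGroup E] [NormedSpace ℝ E]
  [FiniteDimensional ℝ E] {ℓ : V → E →ᴬ[ℝ] ℝ}

theorem finrank_ker_add_one {g : E →L[ℝ] ℝ} (hg : g ≠ 0) :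
    Module.finrank ℝ (g : E →ₗ[ℝ] ℝ).ker + 1 = Module.finrank ℝ E :=
  Module.Dual.finrank_ker_add_one_of_ne_zero (f := (g : E →ₗ[ℝ] ℝ))
    fun h => hg (ContinuousLinearMap.ext fun w => LinearMap.congr_fun h w)

theorem isFacet_slice_singleton (hint : (interior (slice ℓ ∅ 0)).Nonempty) {y : E} {i : V}
    (hi : (ℓ i).contLinear ≠ 0) (hy : ∀ j, 0 ≤ ℓ j y) (hyi : zeroSet ℓ y = {i}) :
    IsFacet (slice ℓ ∅ 0) (slice ℓ {i} 0) := by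
  refine ⟨⟨⟨y, hy, fun j hj => ?_⟩, isExposed_slice (Finset.empty_subset _)⟩, ?_⟩
  · rwa [← hyi, mem_zeroSet] at hj
  · rw [setDim_of_interior_nonempty hint, ← finrank_ker_add_one hi, setDim, ← hyi,
      vectorSpan_slice_zeroSet hy, hyi, Finset.iInf_singleton]

theorem exists_eq_slice_singleton (hint : (interior (slice ℓ ∅ 0)).Nonempty)
    (h : ∀ i, (ℓ i).contLinear ≠ 0 ∧ ∃ y, zeroSet ℓ y = {i}) {G : Set E}
    (hG : IsFacet (slice ℓ ∅ 0) G) : ∃ i, slice ℓ {i} 0 = G := by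
  obtain ⟨hface, hdim⟩ := hG
  obtain ⟨z, hz, rfl⟩ := exists_eq_slice_zeroSet hface
  rw [setDim_of_interior_nonempty hint, setDim, vectorSpan_slice_zeroSet hz.1] at hdim
  obtain ⟨i, hi⟩ : (zeroSet ℓ z).Nonempty := by
    by_contra! hempty
    have htop : ⨅ j ∈ zeroSet ℓ z, ((ℓ j).contLinear : E →ₗ[ℝ] ℝ).ker = ⊤ := by simp [hempty]
    rw [htop, finrank_top] at hdim
    lia
  have hker : ⨅ j ∈ zeroSet ℓ z, ((ℓ j).contLinear : E →ₗ[ℝ] ℝ).ker =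
      ((ℓ i).contLinear : E →ₗ[ℝ] ℝ).ker :=
    Submodule.eq_of_le_of_finrank_eq (iInf₂_le i hi)
      (by have := finrank_ker_add_one (h i).1; lia)
  obtain ⟨y, hy⟩ := (h i).2
  have hyi : ℓ i y = 0 := mem_zeroSet.mp (hy ▸ Finset.mem_singleton_self i)
  have hyz : ∀ j ∈ zeroSet ℓ z, (ℓ j).contLinear (y - z) = 0 := by
    have hmem : y - z ∈ ((ℓ i).contLinear : E →ₗ[ℝ] ℝ).ker := by
      rw [LinearMap.mem_ker, ContinuousLinearMap.coe_coe, contLinear_sub, hyi, mem_zeroSet.mp hi,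
        sub_zero]
    rw [← hker] at hmem
    simpa only [Submodule.mem_iInf, LinearMap.mem_ker, ContinuousLinearMap.coe_coe] using hmem
  refine ⟨i, congrArg (slice ℓ · 0) (Finset.eq_singleton_iff_unique_mem.mpr
    ⟨hi, fun j hj => ?_⟩).symm⟩
  have hyj := hyz j hj
  rwa [contLinear_sub, mem_zeroSet.mp hj, sub_zero, ← mem_zeroSet, hy, Finset.mem_singleton] at hyj

theorem exists_equiv_facet (hint : (interior (slice ℓ ∅ 0)).Nonempty)
    (hirr : ∀ i, ∃ x, ℓ i x < 0 ∧ ∀ j, j ≠ i → 0 ≤ ℓ j x) :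
    ∃ e : V ≃ Facet (slice ℓ ∅ 0), ∀ i, (e i : Set E) = slice ℓ {i} 0 := by
  obtain ⟨p, hp⟩ := hint
  have hpos : ∀ i, 0 < ℓ i p := fun i =>
    let ⟨_, hx, _⟩ := hirr i
    pos_of_mem_interior (interior_mono (fun y hy => hy.1 i) hp) hx
  have hne : ∀ i, (ℓ i).contLinear ≠ 0 := fun i =>
    let ⟨_, hx, _⟩ := hirr i
    contLinear_ne_zero (hx.trans (hpos i)).ne
  choose y hy hyi using fun i =>
    let ⟨_, hx, hxj⟩ := hirr i
    exists_zeroSet_eq_singleton hpos hx hxj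
  refine ⟨.ofBijective (fun i => ⟨_, isFacet_slice_singleton ⟨p, hp⟩ (hne i) (hy i) (hyi i)⟩)
    ⟨fun i k hik => ?_, fun G => ?_⟩, fun i => rfl⟩
  · have hslice : slice ℓ {i} 0 = slice ℓ {k} 0 := congrArg Subtype.val hik
    have hmem : y i ∈ slice ℓ {i} 0 := ⟨hy i, fun j hj => by rwa [← hyi, mem_zeroSet] at hj⟩
    rw [hslice] at hmem
    have hk := mem_zeroSet.mpr (hmem.2 k (Finset.mem_singleton_self k))
    rw [hyi, Finset.mem_singleton] at hk
    exact hk.symm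
  · obtain ⟨i, hi⟩ := exists_eq_slice_singleton ⟨p, hp⟩ (fun i => ⟨hne i, y i, hyi i⟩) G.2
    exact ⟨i, Subtype.ext hi⟩

end Facets

section Presentation

open Set

variable {E : Type} [NormedAddCommGroup E] [NormedSpace ℝ E]

/-- A presentation of a polytope by one inequality for each facet, such that the linear parts of the
inequalities which are sharp at a given point are linearly independent. -/
structure IsSimplePresentation (P : Set E) (ℓ : Facet P → E →ᴬ[ℝ] ℝ) : Prop where
  eq_slice : P = slice ℓ ∅ 0
  facet_eq : ∀ j : Facet P, (j : Set E) = slice ℓ {j} 0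
  isCompact : IsCompact P
  nonempty : P.Nonempty
  exists_vector : ∀ x ∈ P, ∀ y : Facet P → ℝ, ∃ w, ∀ j, ℓ j x = 0 → (ℓ j).contLinear w = y j

namespace IsSimplePolytope

variable {n : ℕ} {P : Set (EuclideanSpace ℝ (Fin n))}

theorem exists_facet_inequalities (hP : IsSimplePolytope P) :
    ∃ (_ : Finite (Facet P)) (ℓ : Facet P → EuclideanSpace ℝ (Fin n) →ᴬ[ℝ] ℝ),
      P = slice ℓ ∅ 0 ∧ ∀ j : Facet P, (j : Set _) = slice ℓ {j} 0 := by
  obtain ⟨m, a, b, hab⟩ := hP.halfspaces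
  let g : Fin m → EuclideanSpace ℝ (Fin n) →ᴬ[ℝ] ℝ := fun i =>
    (innerSL ℝ (a i)).toContinuousAffineMap + ContinuousAffineMap.const ℝ _ (b i)
  obtain ⟨I, hI, hirr⟩ := exists_irredundant fun i => {x | 0 ≤ g i x}
  obtain rfl : P = slice (fun i : I => g i) ∅ 0 := by
    have hP : P = ⋂ i, {x | 0 ≤ g i x} := by
      rw [hab, ofPred_forall]
      rfl
    rw [hP, hI]
    ext x
    simp [slice]
  obtain ⟨e, he⟩ := exists_equiv_facet (ℓ := fun i : I => g i) hP.full_dim fun i => by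
    obtain ⟨x, hx, hxj⟩ := hirr i i.2
    exact ⟨x, not_le.mp hx, fun j hj => hxj j j.2 fun h => hj (Subtype.ext h)⟩
  refine ⟨.of_equiv _ e, fun j => g (e.symm j), ?_, fun j => ?_⟩
  · rw [slice_comp_equiv (fun i : I => g i) e.symm, Finset.map_empty]
  · rw [slice_comp_equiv (fun i : I => g i) e.symm, Finset.map_singleton, ← he]
    exact congrArg Subtype.val (e.apply_symm_apply j).symm

theorem card_zeroSet (hP : IsSimplePolytope P) [Finite (Facet P)]
    {ℓ : Facet P → EuclideanSpace ℝ (Fin n) →ᴬ[ℝ] ℝ}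
    (hℓ : ∀ j : Facet P, (j : Set _) = slice ℓ {j} 0) {v : EuclideanSpace ℝ (Fin n)}
    (hv : v ∈ P.extremePoints ℝ) (hvℓ : ∀ j, 0 ≤ ℓ j v) : (zeroSet ℓ v).card = n := by
  have hval : Function.Injective fun j : Facet P => (j : Set (EuclideanSpace ℝ (Fin n))) :=
    Subtype.val_injective
  have hfacets : {G | IsFacet P G ∧ v ∈ G} = (fun j : Facet P => (j : Set _)) '' zeroSet ℓ v := by
    ext G
    have hmem : ∀ j : Facet P, v ∈ (j : Set _) ↔ j ∈ zeroSet ℓ v := fun j => by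
      rw [hℓ j, mem_zeroSet]
      simp [slice, hvℓ]
    exact ⟨fun ⟨hG, hvG⟩ => ⟨⟨G, hG⟩, (hmem _).mp hvG, rfl⟩,
      fun ⟨j, hj, hjG⟩ => hjG ▸ ⟨j.2, (hmem j).mpr hj⟩⟩
  have hcard := hP.simple v hv
  rw [hfacets, hval.encard_image, encard_coe_eq_coe_finsetCard] at hcard
  exact_mod_cast hcard

theorem exists_presentation (hP : IsSimplePolytope P) :
    ∃ (_ : Finite (Facet P)) (ℓ : Facet P → EuclideanSpace ℝ (Fin n) →ᴬ[ℝ] ℝ),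
      IsSimplePresentation P ℓ := by
  obtain ⟨hfin, ℓ, heq, hℓ⟩ := hP.exists_facet_inequalities
  have hcompact : IsCompact P :=
    Metric.isCompact_of_isClosed_isBounded (heq ▸ isClosed_slice ℓ ∅ 0) hP.bounded
  refine ⟨hfin, ℓ, heq, hℓ, hcompact, hP.full_dim.mono interior_subset, fun x hx y => ?_⟩
  obtain ⟨v, hvx, hv⟩ : ∃ v, zeroSet ℓ x ⊆ zeroSet ℓ v ∧ v ∈ P.extremePoints ℝ := by
    have hexp := isExposed_slice (ℓ := ℓ) (Finset.empty_subset (zeroSet ℓ x))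
    rw [← heq] at hexp
    have hx' : x ∈ slice ℓ ∅ 0 := heq ▸ hx
    obtain ⟨v, hv⟩ := (hexp.isCompact hcompact).extremePoints_nonempty
      ⟨x, hx'.1, fun j => mem_zeroSet.mp⟩
    exact ⟨v, fun j hj => mem_zeroSet.mpr (hv.1.2 j hj),
      hexp.isExtreme.extremePoints_subset_extremePoints hv⟩
  have hv' : v ∈ (slice ℓ ∅ 0).extremePoints ℝ := heq ▸ hv
  let T : EuclideanSpace ℝ (Fin n) →ₗ[ℝ] (zeroSet ℓ v → ℝ) :=
    LinearMap.pi fun j => ((ℓ j).contLinear : EuclideanSpace ℝ (Fin n) →ₗ[ℝ] ℝ)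
  have hT : Function.Injective T := (injective_iff_map_eq_zero T).mpr fun w hw =>
    eq_zero_of_mem_extremePoints hv' fun j hj => congrFun hw ⟨j, hj⟩
  obtain ⟨w, hw⟩ := (LinearMap.injective_iff_surjective_of_finrank_eq_finrank (by
    rw [finrank_euclideanSpace_fin, Module.finrank_fintype_fun_eq_card, Fintype.card_coe,
      hP.card_zeroSet hℓ hv hv'.1.1])).mp hT fun j => y j
  exact ⟨w, fun j hj => congrFun hw ⟨j, hvx (mem_zeroSet.mpr hj)⟩⟩

end IsSimplePolytope

end Presentation

section FlagComplexes

variable {V : Type}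

/-- The simplices of `K` including the empty one, which is not recorded in `K`. -/
def simplices (K : PreAbstractSimplicialComplex V) : Set (Finset V) :=
  {σ | σ.Nonempty → σ ∈ K}

theorem isLowerSet_simplices (K : PreAbstractSimplicialComplex V) : IsLowerSet (simplices K) :=
  fun _ _ hτσ hσ hne => (K.isRelLowerSet_faces (hσ (hne.mono hτσ))).2 hτσ hne

theorem IsFlagComplex.mem_of_card_le_two {K : PreAbstractSimplicialComplex V}
    (hK : IsFlagComplex K) {σ : Finset V}
    (h : ∀ τ ⊆ σ, τ.Nonempty → τ.card ≤ 2 → τ ∈ K) : σ ∈ simplices K := by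
  intro hne
  by_contra hσ
  obtain ⟨J, hJσ, hJ⟩ := exists_minimal_le_of_wellFoundedLT
    (fun τ : Finset V => τ.Nonempty ∧ τ ∉ K) σ ⟨hne, hσ⟩
  have hcard : 2 < J.card := by
    by_contra! hle
    exact hJ.prop.2 (h J hJσ hJ.prop.1 hle)
  refine hcard.ne' (hK J ⟨hcard.le, fun τ hτ hτJ => ⟨?_, fun hne => ?_⟩⟩)
  · rintro hτK rfl
    exact hJ.prop.2 hτK
  · by_contra hτK
    exact hne (le_antisymm hτJ (hJ.le_of_le ⟨hτ, hτK⟩ hτJ))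

/-- The simplices `τ` disjoint from `σ` such that `τ ∪ σ` is a simplex, including the empty one. -/
def link [DecidableEq V] (K : PreAbstractSimplicialComplex V) (σ : Finset V) : Set (Finset V) :=
  {τ | Disjoint τ σ ∧ τ ∪ σ ∈ simplices K}

theorem isLowerSet_link [DecidableEq V] (K : PreAbstractSimplicialComplex V) (σ : Finset V) :
    IsLowerSet (link K σ) := fun _ _ hρτ hτ =>
  ⟨hτ.1.mono_left hρτ, isLowerSet_simplices K (Finset.union_subset_union_left hρτ) hτ.2⟩

theorem singleton_mem_link_iff [DecidableEq V] {K : PreAbstractSimplicialComplex V} {σ : Finset V}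
    {j : V} : {j} ∈ link K σ ↔ j ∉ σ ∧ insert j σ ∈ simplices K :=
  and_congr_left fun _ => Finset.disjoint_singleton_left

theorem IsFlagComplex.mem_link [DecidableEq V] {K : PreAbstractSimplicialComplex V}
    (hK : IsFlagComplex K) {σ τ : Finset V} (hσ : σ ∈ simplices K) (hτ : τ ∈ simplices K)
    (h : ∀ j ∈ τ, {j} ∈ link K σ) : τ ∈ link K σ := by
  simp only [singleton_mem_link_iff] at h
  refine ⟨Finset.disjoint_left.mpr fun j hj => (h j hj).1,
    hK.mem_of_card_le_two fun ρ hρ hne hcard => ?_⟩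
  suffices ρ ∈ simplices K from this hne
  by_cases hρσ : ρ ⊆ σ
  · exact isLowerSet_simplices K hρσ hσ
  by_cases hρτ : ρ ⊆ τ
  · exact isLowerSet_simplices K hρτ hτ
  obtain ⟨i, hi, hiσ⟩ := Finset.not_subset.mp hρσ
  obtain ⟨l, hl, hlτ⟩ := Finset.not_subset.mp hρτ
  have hiτ : i ∈ τ := (Finset.mem_union.mp (hρ hi)).resolve_right hiσ
  have hlσ : l ∈ σ := (Finset.mem_union.mp (hρ hl)).resolve_left hlτ
  have hil : i ≠ l := fun hil => hiσ (hil ▸ hlσ)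
  have hρil : ρ = {i, l} := (Finset.eq_of_subset_of_card_le (by grind)
    (hcard.trans (Finset.card_pair hil).ge)).symm
  refine isLowerSet_simplices K ?_ (h i hiτ).2
  rw [hρil]
  exact Finset.insert_subset_insert i (Finset.singleton_subset_iff.mpr hlσ)

end FlagComplexes

section FacesOfSimplePolytopes

open Set Filter Topology

namespace IsSimplePresentation

variable {E : Type} [NormedAddCommGroup E] [NormedSpace ℝ E] {P : Set E}
  {ℓ : Facet P → E →ᴬ[ℝ] ℝ}

theorem mem_iff (S : IsSimplePresentation P ℓ) {x : E} : x ∈ P ↔ ∀ j, 0 ≤ ℓ j x := by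
  nth_rw 1 [S.eq_slice]
  simp [slice]

theorem mem_slice_iff (S : IsSimplePresentation P ℓ) {σ : Finset (Facet P)} {s : ℝ} {x : E} :
    x ∈ slice ℓ σ s ↔ x ∈ P ∧ ∀ j ∈ σ, ℓ j x = s := by
  rw [S.mem_iff]
  rfl

theorem mem_facet_iff (S : IsSimplePresentation P ℓ) {x : E} (hx : x ∈ P) {j : Facet P} :
    x ∈ (j : Set E) ↔ ℓ j x = 0 := by
  simp only [S.facet_eq j, S.mem_slice_iff, Finset.mem_singleton, forall_eq, hx, true_and]

theorem mem_simplices_iff (S : IsSimplePresentation P ℓ) {σ : Finset (Facet P)} :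
    σ ∈ simplices (nerveComplex P) ↔ (slice ℓ σ 0).Nonempty := by
  have hslice : ∀ x, x ∈ slice ℓ σ 0 ↔ x ∈ P ∧ ∀ j ∈ σ, x ∈ (j : Set E) := fun x =>
    S.mem_slice_iff.trans (and_congr_right fun hx =>
      forall₂_congr fun j _ => (S.mem_facet_iff hx).symm)
  refine ⟨fun h => ?_, fun ⟨x, hx⟩ hne => ⟨hne, x, mem_iInter₂.mpr ((hslice x).mp hx).2⟩⟩
  rcases σ.eq_empty_or_nonempty with rfl | ⟨j, hj⟩
  · exact S.eq_slice ▸ S.nonempty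
  · obtain ⟨-, x, hx⟩ := h ⟨j, hj⟩
    rw [mem_iInter₂] at hx
    exact ⟨x, (hslice x).mpr ⟨j.subset (hx j hj), hx⟩⟩

theorem slice_insert [DecidableEq (Facet P)] (S : IsSimplePresentation P ℓ)
    (σ : Finset (Facet P)) (j : Facet P) : slice ℓ (insert j σ) 0 = slice ℓ σ 0 ∩ (j : Set E) := by
  ext x
  simp only [S.facet_eq j, mem_inter_iff, S.mem_slice_iff, Finset.forall_mem_insert,
    Finset.mem_singleton, forall_eq]
  tauto

section

variable {σ : Finset (Facet P)} {φ : Facet (slice ℓ σ 0) → Facet P}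

theorem facet_eq_slice_insert [DecidableEq (Facet P)] (S : IsSimplePresentation P ℓ)
    (hφ : IsFacetMap P (slice ℓ σ 0) φ) (G : Facet (slice ℓ σ 0)) :
    (G : Set E) = slice ℓ (insert (φ G) σ) 0 :=
  (hφ G).trans (S.slice_insert σ (φ G)).symm

theorem facetMap_notMem (S : IsSimplePresentation P ℓ) (hφ : IsFacetMap P (slice ℓ σ 0) φ)
    (G : Facet (slice ℓ σ 0)) : φ G ∉ σ := by
  classical
  intro h
  have hdim := G.2.2
  rw [show G.1 = _ from S.facet_eq_slice_insert hφ G, Finset.insert_eq_of_mem h] at hdim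
  lia

theorem insert_facetMap_mem [DecidableEq (Facet P)] (S : IsSimplePresentation P ℓ)
    (hφ : IsFacetMap P (slice ℓ σ 0) φ) (G : Facet (slice ℓ σ 0)) :
    insert (φ G) σ ∈ simplices (nerveComplex P) :=
  S.mem_simplices_iff.mpr (S.facet_eq_slice_insert hφ G ▸ G.2.1.1)

end

variable [Finite (Facet P)]

theorem exists_eventually_zeroSet_eq (S : IsSimplePresentation P ℓ) {ρ : Finset (Facet P)} {x : E}
    (hx : x ∈ P) (hρ : ρ ⊆ zeroSet ℓ x) :
    ∃ w, ∀ᶠ r in 𝓝[>] (0 : ℝ), x + r • w ∈ P ∧ zeroSet ℓ (x + r • w) = ρ ∧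
      ∀ j ∈ zeroSet ℓ x, j ∉ ρ → ℓ j (x + r • w) = r := by
  classical
  obtain ⟨w, hw⟩ := S.exists_vector x hx fun j => if j ∈ ρ then 0 else 1
  have hval : ∀ r, ∀ j ∈ zeroSet ℓ x, ℓ j (x + r • w) = if j ∈ ρ then 0 else r := fun r j hj => by
    rw [mem_zeroSet] at hj
    rw [apply_add_smul, hj, hw j hj]
    split_ifs <;> simp
  refine ⟨w, ?_⟩
  filter_upwards [self_mem_nhdsWithin, nhdsWithin_le_nhds
    (eventually_pos_of_notMem_zeroSet (S.mem_iff.mp hx) w)] with r hr hpos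
  rw [mem_Ioi] at hr
  refine ⟨S.mem_iff.mpr fun j => ?_, ?_, fun j hj hjρ => by rw [hval r j hj, if_neg hjρ]⟩
  · by_cases hj : j ∈ zeroSet ℓ x
    · rw [hval r j hj]
      split_ifs <;> simp [hr.le]
    · exact (hpos j hj).le
  · ext j
    rw [mem_zeroSet]
    by_cases hj : j ∈ zeroSet ℓ x
    · simp [hval r j hj, hr.ne']
    · exact iff_of_false (hpos j hj).ne' (mt (@hρ j) hj)

theorem exists_zeroSet_eq (S : IsSimplePresentation P ℓ) {σ : Finset (Facet P)}
    (hσ : σ ∈ simplices (nerveComplex P)) : ∃ z ∈ P, zeroSet ℓ z = σ := by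
  obtain ⟨x, hx⟩ := S.mem_simplices_iff.mp hσ
  obtain ⟨w, hw⟩ := S.exists_eventually_zeroSet_eq (S.mem_iff.mpr hx.1) (ρ := σ)
    fun j hj => mem_zeroSet.mpr (hx.2 j hj)
  obtain ⟨r, hr⟩ := hw.exists
  exact ⟨_, hr.1, hr.2.1⟩

theorem zeroSet_mem_simplices (S : IsSimplePresentation P ℓ) {x : E} (hx : x ∈ P) :
    zeroSet ℓ x ∈ simplices (nerveComplex P) :=
  S.mem_simplices_iff.mpr ⟨x, S.mem_iff.mp hx, fun _ => mem_zeroSet.mp⟩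

theorem subset_of_slice_subset (S : IsSimplePresentation P ℓ) {σ τ : Finset (Facet P)}
    (hσ : σ ∈ simplices (nerveComplex P)) (h : slice ℓ σ 0 ⊆ slice ℓ τ 0) : τ ⊆ σ := by
  obtain ⟨z, hz, rfl⟩ := S.exists_zeroSet_eq hσ
  exact fun j hj => mem_zeroSet.mpr ((h ⟨S.mem_iff.mp hz, fun _ => mem_zeroSet.mp⟩).2 j hj)

theorem setDim_slice_add_card [FiniteDimensional ℝ E] (S : IsSimplePresentation P ℓ)
    {σ : Finset (Facet P)} (hσ : σ ∈ simplices (nerveComplex P)) :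
    setDim (slice ℓ σ 0) + σ.card = Module.finrank ℝ E := by
  classical
  obtain ⟨z, hz, rfl⟩ := S.exists_zeroSet_eq hσ
  let T : E →ₗ[ℝ] (zeroSet ℓ z → ℝ) := LinearMap.pi fun j => ((ℓ j).contLinear : E →ₗ[ℝ] ℝ)
  have hT : Function.Surjective T := fun y => by
    obtain ⟨w, hw⟩ := S.exists_vector z hz fun j => if h : j ∈ zeroSet ℓ z then y ⟨j, h⟩ else 0
    exact ⟨w, funext fun j => (hw j (mem_zeroSet.mp j.2)).trans (by simp)⟩
  have hker : T.ker = ⨅ j ∈ zeroSet ℓ z, ((ℓ j).contLinear : E →ₗ[ℝ] ℝ).ker := by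
    rw [LinearMap.ker_pi, iInf_subtype]
  rw [setDim, vectorSpan_slice_zeroSet (S.mem_iff.mp hz), ← hker, add_comm,
    ← T.finrank_range_add_finrank_ker, LinearMap.range_eq_top.mpr hT, finrank_top,
    Module.finrank_fintype_fun_eq_card, Fintype.card_coe]

theorem exists_eq_slice (S : IsSimplePresentation P ℓ) {F : Set E} (hF : IsFace P F) :
    ∃ σ ∈ simplices (nerveComplex P), F = slice ℓ σ 0 := by
  rw [S.eq_slice] at hF
  obtain ⟨z, hz, hFz⟩ := exists_eq_slice_zeroSet hF
  exact ⟨_, S.mem_simplices_iff.mpr (hFz ▸ ⟨z, hz⟩), hFz⟩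

theorem isFacet_slice_iff [FiniteDimensional ℝ E] [DecidableEq (Facet P)]
    (S : IsSimplePresentation P ℓ) {σ : Finset (Facet P)} (hσ : σ ∈ simplices (nerveComplex P))
    {G : Set E} : IsFacet (slice ℓ σ 0) G ↔
      ∃ j ∉ σ, insert j σ ∈ simplices (nerveComplex P) ∧ G = slice ℓ (insert j σ) 0 := by
  have hdimσ := S.setDim_slice_add_card hσ
  constructor
  · rintro ⟨hG, hdim⟩
    obtain ⟨z, hz, hGz⟩ := exists_eq_slice_zeroSet hG
    have hzσ : z ∈ slice ℓ σ 0 := hG.2.subset hz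
    have hτ := S.zeroSet_mem_simplices (S.mem_iff.mpr hzσ.1)
    have hστ : σ ⊆ zeroSet ℓ z := fun j hj => mem_zeroSet.mpr (hzσ.2 j hj)
    have hdimτ := S.setDim_slice_add_card hτ
    rw [← hGz] at hdimτ
    obtain ⟨j, hj⟩ := Finset.card_eq_one.mp (show (zeroSet ℓ z \ σ).card = 1 by
      rw [Finset.card_sdiff_of_subset hστ]
      lia)
    have hinsert : zeroSet ℓ z = insert j σ := by
      rw [Finset.insert_eq, ← hj, Finset.sdiff_union_of_subset hστ]
    exact ⟨j, (Finset.mem_sdiff.mp (hj ▸ Finset.mem_singleton_self j)).2, hinsert ▸ hτ,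
      hinsert ▸ hGz⟩
  · rintro ⟨j, hj, hne, rfl⟩
    have hdimj := S.setDim_slice_add_card hne
    rw [Finset.card_insert_of_notMem hj] at hdimj
    exact ⟨⟨S.mem_simplices_iff.mp hne, isExposed_slice (Finset.subset_insert j σ)⟩, by lia⟩

variable {σ : Finset (Facet P)} {φ : Facet (slice ℓ σ 0) → Facet P}

theorem exists_isFacetMap [FiniteDimensional ℝ E] (S : IsSimplePresentation P ℓ)
    (hσ : σ ∈ simplices (nerveComplex P)) :
    ∃ φ : Facet (slice ℓ σ 0) → Facet P, IsFacetMap P (slice ℓ σ 0) φ := by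
  classical
  choose φ _ _ hφ using fun G : Facet (slice ℓ σ 0) => (S.isFacet_slice_iff hσ).mp G.2
  exact ⟨φ, fun G => (hφ G).trans (S.slice_insert σ (φ G))⟩

theorem facetMap_eq_iff [DecidableEq (Facet P)] (S : IsSimplePresentation P ℓ)
    (hφ : IsFacetMap P (slice ℓ σ 0) φ) {G : Facet (slice ℓ σ 0)} {j : Facet P} :
    φ G = j ↔ j ∉ σ ∧ (G : Set E) = slice ℓ (insert j σ) 0 := by
  refine ⟨?_, fun ⟨hj, hG⟩ => ?_⟩
  · rintro rfl
    exact ⟨S.facetMap_notMem hφ G, S.facet_eq_slice_insert hφ G⟩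
  · have hsub := S.subset_of_slice_subset (S.insert_facetMap_mem hφ G)
      ((S.facet_eq_slice_insert hφ G).symm.trans hG).subset
    exact ((Finset.mem_insert.mp (hsub (Finset.mem_insert_self j σ))).resolve_right hj).symm

theorem facetMap_unique (S : IsSimplePresentation P ℓ) (hφ : IsFacetMap P (slice ℓ σ 0) φ)
    {ψ : Facet (slice ℓ σ 0) → Facet P} (hψ : IsFacetMap P (slice ℓ σ 0) ψ) : ψ = φ := by
  classical
  exact funext fun G => ((S.facetMap_eq_iff hφ).mpr
    ⟨S.facetMap_notMem hψ G, S.facet_eq_slice_insert hψ G⟩).symm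

theorem mem_range_facetMap_iff [FiniteDimensional ℝ E] [DecidableEq (Facet P)]
    (S : IsSimplePresentation P ℓ) (hσ : σ ∈ simplices (nerveComplex P))
    (hφ : IsFacetMap P (slice ℓ σ 0) φ) {j : Facet P} :
    j ∈ range φ ↔ {j} ∈ link (nerveComplex P) σ := by
  rw [singleton_mem_link_iff]
  constructor
  · rintro ⟨G, rfl⟩
    exact ⟨S.facetMap_notMem hφ G, S.insert_facetMap_mem hφ G⟩
  · rintro ⟨hj, hne⟩
    exact ⟨⟨_, (S.isFacet_slice_iff hσ).mpr ⟨j, hj, hne, rfl⟩⟩,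
      (S.facetMap_eq_iff hφ).mpr ⟨hj, rfl⟩⟩

theorem imageComplex_facetMap_eq [FiniteDimensional ℝ E] (S : IsSimplePresentation P ℓ)
    (hflag : IsFlagComplex (nerveComplex P)) (hσ : σ ∈ simplices (nerveComplex P))
    (hφ : IsFacetMap P (slice ℓ σ 0) φ) :
    imageComplex φ (nerveComplex (slice ℓ σ 0)) = fullSubcomplex (nerveComplex P) (range φ) := by
  classical
  apply le_antisymm
  · intro τ hτ
    refine ⟨hφ.isSimplicialEmbedding.simplicial hτ, ?_⟩
    obtain ⟨ρ, -, rfl⟩ := hτ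
    simp
  · rintro τ ⟨hτ, hrange⟩
    have hlink := hflag.mem_link hσ (fun _ => hτ)
      fun j hj => (S.mem_range_facetMap_iff hσ hφ).mp (hrange hj)
    obtain ⟨x, hx⟩ := S.mem_simplices_iff.mp hlink.2
    obtain ⟨ρ, -, rfl⟩ := Finset.subset_set_image_iff.mp (image_univ ▸ hrange)
    refine ⟨ρ, ⟨Finset.image_nonempty.mp ((nerveComplex P).isRelLowerSet_faces hτ).1, x, ?_⟩, ?_⟩
    · refine mem_iInter₂.mpr fun G hG => ?_
      rw [S.facet_eq_slice_insert hφ G]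
      exact slice_anti (Finset.insert_subset (Finset.mem_union_left _
        (Finset.mem_image_of_mem φ hG)) Finset.subset_union_right) 0 hx
    · ext
      simp

end IsSimplePresentation

end FacesOfSimplePolytopes

section Levels

open Set Filter Topology

/-- The functions `ℓ i` with `i ∈ σ` are at least `δ` at the points `b τ` with `τ ∈ K` and `i ∉ τ`,
with equality if `τ` and `σ` span a simplex of `K`. -/
structure IsNormalizedAlong {V E : Type} [NormedAddCommGroup E] [NormedSpace ℝ E]
    (ℓ : V → E →ᴬ[ℝ] ℝ) (σ : Finset V) (δ : ℝ) (K : Set (Finset V)) (b : Finset V → E) : Prop where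
  le : ∀ τ ∈ K, ∀ i ∈ σ, i ∉ τ → δ ≤ ℓ i (b τ)
  eq : ∀ ρ ∈ K, σ ⊆ ρ → ∀ τ ⊆ ρ, ∀ i ∈ σ, i ∉ τ → ℓ i (b τ) = δ

section

variable {V E : Type} [Finite V] [NormedAddCommGroup E] [NormedSpace ℝ E] [CompleteSpace E]
  {ℓ : V → E →ᴬ[ℝ] ℝ} {σ ρ : Finset V} {δ : ℝ} {K : Set (Finset V)} {b : Finset V → E} {u : V → ℝ}

namespace IsBarycentricSystem

theorem mul_one_sub_le (h : IsBarycentricSystem ℓ ∅ 0 K b) (hb : IsNormalizedAlong ℓ σ δ K b)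
    (hu : u ∈ cubicalComplex K) {i : V} (hi : i ∈ σ) :
    δ * (1 - u i) ≤ ℓ i (layerIntegral b u) := by
  have hu01 := cubicalComplex_subset_Icc K hu
  rw [map_layerIntegral]
  refine mul_one_sub_le_layerIntegral ⟨hu01.1 i, hu01.2 i⟩ fun t ht => ?_
  have hK := superlevel_mem h.isLowerSet hu ht.1
  split_ifs with hti
  · exact (h.mem _ hK).1 i
  · exact hb.le _ hK i hi (mt mem_superlevel.mp hti)

theorem eq_mul_one_sub (h : IsBarycentricSystem ℓ ∅ 0 K b) (hb : IsNormalizedAlong ℓ σ δ K b)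
    (hρ : ρ ∈ K) (hσρ : σ ⊆ ρ) (hu : u ∈ Icc 0 ((ρ : Set V).indicator 1)) {i : V} (hi : i ∈ σ) :
    ℓ i (layerIntegral b u) = δ * (1 - u i) := by
  have huK : u ∈ cubicalComplex K := mem_cubicalComplex.mpr ⟨ρ, hρ, hu⟩
  have hu01 := cubicalComplex_subset_Icc K huK
  rw [map_layerIntegral]
  refine layerIntegral_eq_mul_one_sub ⟨hu01.1 i, hu01.2 i⟩ fun t ht => ?_
  have hK := superlevel_mem h.isLowerSet huK ht.1
  split_ifs with hti
  · rw [← mem_zeroSet, h.zeroSet_eq _ hK, mem_superlevel]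
    exact hti
  · exact hb.eq ρ hρ hσρ _ (superlevel_subset_of_le_indicator hu ht.1) i hi
      (mt mem_superlevel.mp hti)

theorem exists_superset_of_lt (h : IsBarycentricSystem ℓ ∅ 0 K b)
    (hb : IsNormalizedAlong ℓ σ δ K b) (hu : u ∈ cubicalComplex K)
    (hlt : ∀ i ∈ σ, ℓ i (layerIntegral b u) < δ) :
    ∃ ρ ∈ K, σ ⊆ ρ ∧ u ∈ Icc 0 ((ρ : Set V).indicator 1) := by
  obtain ⟨ρ, hρ, huρ⟩ := mem_cubicalComplex.mp hu
  refine ⟨ρ, hρ, fun i hi => ?_, huρ⟩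
  by_contra hiρ
  have hle := h.mul_one_sub_le hb hu hi
  rw [eq_zero_of_le_indicator huρ hiρ, sub_zero, mul_one] at hle
  exact hle.not_gt (hlt i hi)

variable [DecidableEq V] {L : PreAbstractSimplicialComplex V}

theorem layerIntegral_mem_slice_mul_iff (h : IsBarycentricSystem ℓ ∅ 0 (simplices L) b)
    (hb : IsNormalizedAlong ℓ σ δ (simplices L) b) (hδ : 0 < δ) {r : ℝ} (hr : r < 1)
    (hu : u ∈ cubicalComplex (simplices L)) :
    layerIntegral b u ∈ slice ℓ σ (δ * r) ↔
      ∀ j, {j} ∉ link L σ → u j = if j ∈ σ then 1 - r else 0 := by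
  refine (and_iff_right (h.layerIntegral_mem hu).1).trans ⟨?_, ?_⟩
  · intro hlevel
    obtain ⟨ρ, hρ, hσρ, huρ⟩ := h.exists_superset_of_lt hb hu fun i hi => by
      rw [hlevel i hi]
      exact mul_lt_of_lt_one_right hδ hr
    intro j hj
    split_ifs with hjσ
    · have := hlevel j hjσ
      rw [h.eq_mul_one_sub hb hρ hσρ huρ hjσ, mul_right_inj' hδ.ne'] at this
      linarith
    · refine eq_zero_of_le_indicator huρ fun hjρ => hj (singleton_mem_link_iff.mpr ⟨hjσ, ?_⟩)
      exact h.isLowerSet (Finset.insert_subset hjρ hσρ) hρ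
  · intro hcoord i hi
    obtain ⟨ρ, hρ, huρ⟩ := mem_cubicalComplex.mp hu
    have hσu : ∀ i ∈ σ, u i = 1 - r := fun i hi => by
      rw [hcoord i fun hlink => (singleton_mem_link_iff.mp hlink).1 hi, if_pos hi]
    have hσρ : σ ⊆ ρ := fun i hi => by
      by_contra hiρ
      linarith [hσu i hi, eq_zero_of_le_indicator huρ hiρ]
    rw [h.eq_mul_one_sub hb hρ hσρ huρ hi, hσu i hi, sub_sub_cancel]

theorem slice_link (h : IsBarycentricSystem ℓ ∅ 0 (simplices L) b)
    (hb : IsNormalizedAlong ℓ σ δ (simplices L) b) (hδ : 0 < δ) {δ' : ℝ} (hδδ' : δ < δ')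
    {b' : Finset V → E} (h' : IsBarycentricSystem ℓ ∅ 0 (simplices L) b')
    (hb' : IsNormalizedAlong ℓ σ δ' (simplices L) b') :
    IsBarycentricSystem ℓ σ δ (link L σ) b where
  isCompact := h.isCompact.of_isClosed_subset (isClosed_slice ℓ σ δ) fun x hx => ⟨hx.1, by simp⟩
  zeroSet_mem x hx := by
    obtain ⟨u, hu, rfl⟩ := h'.surjOn (⟨hx.1, by simp⟩ : x ∈ slice ℓ ∅ 0)
    obtain ⟨ρ, hρ, hσρ, huρ⟩ := h'.exists_superset_of_lt hb' hu
      fun i hi => (hx.2 i hi).trans_lt hδδ'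
    refine ⟨Finset.disjoint_right.mpr fun i hi hi0 => ?_,
      h.isLowerSet (Finset.union_subset ?_ hσρ) hρ⟩
    · rw [mem_zeroSet, hx.2 i hi] at hi0
      exact hδ.ne' hi0
    · rw [h'.zeroSet_layerIntegral hu]
      exact superlevel_subset_of_le_indicator huρ one_pos
  isLowerSet := isLowerSet_link _ _
  mem τ hτ := ⟨(h.mem τ (h.isLowerSet Finset.subset_union_left hτ.2)).1, fun i hi =>
    hb.eq _ hτ.2 Finset.subset_union_right τ Finset.subset_union_left i hi
      (Finset.disjoint_right.mp hτ.1 hi)⟩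
  zeroSet_eq τ hτ := h.zeroSet_eq τ (h.isLowerSet Finset.subset_union_left hτ.2)

theorem layerIntegral_mem_slice_iff (h : IsBarycentricSystem ℓ ∅ 0 (simplices L) b)
    (hL : IsFlagComplex L) (hσ : σ ∈ simplices L)
    (hb : IsNormalizedAlong ℓ σ δ (simplices L) b)
    (hlink : IsBarycentricSystem ℓ σ δ (link L σ) b)
    (hu : u ∈ cubicalComplex (simplices L)) :
    layerIntegral b u ∈ slice ℓ σ δ ↔ ∀ j, {j} ∉ link L σ → u j = 0 := by
  refine (and_iff_right (h.layerIntegral_mem hu).1).trans ⟨?_, ?_⟩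
  · intro hlevel j hj
    obtain ⟨v, hv, hvu⟩ := hlink.surjOn ⟨(h.layerIntegral_mem hu).1, hlevel⟩
    obtain ⟨τ, hτ, hvτ⟩ := mem_cubicalComplex.mp hv
    have hvK : v ∈ cubicalComplex (simplices L) := mem_cubicalComplex.mpr
      ⟨τ, h.isLowerSet Finset.subset_union_left hτ.2, hvτ⟩
    rw [← h.injOn hvK hu hvu]
    exact eq_zero_of_le_indicator hvτ fun hjτ =>
      hj (isLowerSet_link _ σ (Finset.singleton_subset_iff.mpr hjτ) hτ)
  · intro hcoord i hi
    obtain ⟨ρ, hρ, huρ⟩ := mem_cubicalComplex.mp hu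
    classical
    set τ := ρ.filter fun j => {j} ∈ link L σ
    have hτ : τ ∈ link L σ := hL.mem_link hσ
      (h.isLowerSet (Finset.filter_subset _ ρ) hρ) fun j hj => (Finset.mem_filter.mp hj).2
    have huτ : u ∈ Icc 0 (((τ ∪ σ : Finset _) : Set _).indicator 1) := by
      refine ⟨huρ.1, fun j => ?_⟩
      by_cases hj : {j} ∈ link L σ ∧ j ∈ ρ
      · simpa [τ, hj] using (cubicalComplex_subset_Icc _ hu).2 j
      · have hj0 : u j = 0 := by
          rcases not_and_or.mp hj with hj | hj
          exacts [hcoord j hj, eq_zero_of_le_indicator huρ hj]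
        rw [hj0]
        exact indicator_nonneg (fun _ _ => zero_le_one) j
    rw [h.eq_mul_one_sub hb hτ.2 Finset.subset_union_right huτ hi,
      hcoord i fun hlink => (singleton_mem_link_iff.mp hlink).1 hi, sub_zero, mul_one]

end IsBarycentricSystem

end

namespace IsSimplePresentation

variable {E : Type} [NormedAddCommGroup E] [NormedSpace ℝ E] {P : Set E}
  {ℓ : Facet P → E →ᴬ[ℝ] ℝ} [Finite (Facet P)]

theorem isBarycentricSystem (S : IsSimplePresentation P ℓ) {b : Finset (Facet P) → E}
    (hb : ∀ τ ∈ simplices (nerveComplex P), b τ ∈ P ∧ zeroSet ℓ (b τ) = τ) :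
    IsBarycentricSystem ℓ ∅ 0 (simplices (nerveComplex P)) b where
  isCompact := S.eq_slice ▸ S.isCompact
  zeroSet_mem _ hx := S.zeroSet_mem_simplices (S.mem_iff.mpr hx.1)
  isLowerSet := isLowerSet_simplices _
  mem τ hτ := S.mem_slice_iff.mpr ⟨(hb τ hτ).1, by simp⟩
  zeroSet_eq τ hτ := (hb τ hτ).2

theorem eventually_exists_normalized (S : IsSimplePresentation P ℓ) (σ : Finset (Facet P)) :
    ∀ᶠ δ in 𝓝[>] (0 : ℝ), ∃ b,
      IsBarycentricSystem ℓ ∅ 0 (simplices (nerveComplex P)) b ∧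
        IsNormalizedAlong ℓ σ δ (simplices (nerveComplex P)) b := by
  have hpoint : ∀ᶠ δ in 𝓝[>] (0 : ℝ), ∀ τ : simplices (nerveComplex P), ∃ x ∈ P,
      zeroSet ℓ x = τ ∧ (∀ i ∈ σ, i ∉ τ.1 → δ ≤ ℓ i x) ∧
      ((∃ ρ ∈ simplices (nerveComplex P), σ ⊆ ρ ∧ τ.1 ⊆ ρ) →
        ∀ i ∈ σ, i ∉ τ.1 → ℓ i x = δ) := by
    refine eventually_all.mpr fun ⟨τ, hτ⟩ => ?_
    by_cases hστ : ∃ ρ ∈ simplices (nerveComplex P), σ ⊆ ρ ∧ τ ⊆ ρ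
    · obtain ⟨ρ, hρ, hσρ, hτρ⟩ := hστ
      obtain ⟨z, hz, rfl⟩ := S.exists_zeroSet_eq hρ
      obtain ⟨w, hw⟩ := S.exists_eventually_zeroSet_eq hz hτρ
      filter_upwards [hw] with δ ⟨hP, hzero, hδ⟩
      exact ⟨_, hP, hzero, fun i hi hiτ => (hδ i (hσρ hi) hiτ).ge,
        fun _ i hi hiτ => hδ i (hσρ hi) hiτ⟩
    · obtain ⟨z, hz, rfl⟩ := S.exists_zeroSet_eq hτ
      have hle : ∀ᶠ δ in 𝓝[>] (0 : ℝ), ∀ i, i ∉ zeroSet ℓ z → δ ≤ ℓ i z := by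
        refine eventually_all.mpr fun i => ?_
        by_cases hi : ℓ i z = 0
        · simp [hi]
        · filter_upwards [nhdsWithin_le_nhds (gt_mem_nhds ((S.mem_iff.mp hz i).lt_of_ne' hi))]
            with δ hδ _ using hδ.le
      exact hle.mono fun δ hδ => ⟨z, hz, rfl, fun i _ => hδ i, fun h => absurd h hστ⟩
  refine hpoint.mono fun δ hδ => ?_
  choose! b hbP hbzero hble hbeq using hδ
  refine ⟨fun τ => open Classical in if h : τ ∈ simplices (nerveComplex P) then b ⟨τ, h⟩ else 0,
    S.isBarycentricSystem fun τ hτ => ?_, fun τ hτ => ?_, fun ρ hρ hσρ τ hτρ => ?_⟩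
  · simp [hτ, hbP, hbzero]
  · simpa [hτ] using hble ⟨τ, hτ⟩
  · have hτ := isLowerSet_simplices _ hτρ hρ
    simpa [hτ] using hbeq ⟨τ, hτ⟩ ⟨ρ, hρ, hσρ, hτρ⟩

end IsSimplePresentation

end Levels

section MomentAngleHomeomorphism

open Set Filter Topology

namespace MomentAngleManifold

variable {E : Type} [NormedAddCommGroup E] [NormedSpace ℝ E] {C : Set E}

/-- The class `[t, p]` in the moment-angle manifold. -/
def mk (t : Facet C → Circle) (p : C) : MomentAngleManifold C :=
  Quotient.mk (momentAngleSetoid C) (t, p)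

theorem mk_eq_mk_iff {t s : Facet C → Circle} {p q : C} :
    mk t p = mk s q ↔ p = q ∧ ∀ G : Facet C, (p : E) ∉ (G : Set E) → t G = s G := by
  refine Quotient.eq.trans (and_congr_right fun _ => forall₂_congr fun G _ => ?_)
  simp [mul_inv_eq_one]

theorem exists_mk (x : MomentAngleManifold C) : ∃ t p, mk t p = x := by
  obtain ⟨⟨t, p⟩, rfl⟩ := Quotient.exists_rep x
  exact ⟨t, p, rfl⟩

theorem compactSpace (hC : IsCompact C) : CompactSpace (MomentAngleManifold C) := by
  have : CompactSpace C := isCompact_iff_compactSpace.mp hC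
  exact inferInstanceAs (CompactSpace (Quotient (momentAngleSetoid C)))

theorem exists_homeomorph (hC : IsCompact C) {X : Type} [TopologicalSpace X] [T2Space X]
    (g : (Facet C → Circle) × C → X) (hg : Continuous g) (hsurj : Function.Surjective g)
    (hiff : ∀ t p s q, g (t, p) = g (s, q) ↔
      p = q ∧ ∀ G : Facet C, (p : E) ∉ (G : Set E) → t G = s G) :
    ∃ H : MomentAngleManifold C ≃ₜ X, ∀ t p, H (mk t p) = g (t, p) := by
  have := compactSpace hC
  let H : MomentAngleManifold C → X :=
    Quotient.lift g fun x y hxy => (hiff x.1 x.2 y.1 y.2).mpr (mk_eq_mk_iff.mp (Quotient.sound hxy))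
  have hH : Continuous H := hg.quotient_lift _
  have hinj : Function.Injective H := fun x y hxy => by
    obtain ⟨t, p, rfl⟩ := exists_mk x
    obtain ⟨s, q, rfl⟩ := exists_mk y
    exact mk_eq_mk_iff.mpr ((hiff t p s q).mp hxy)
  have hbij : Function.Bijective H := ⟨hinj, fun z => (hsurj z).imp' (Quotient.mk _) fun _ => id⟩
  exact ⟨Continuous.homeoOfEquivCompactToT2 (f := Equiv.ofBijective H hbij) hH, fun _ _ => rfl⟩

/-- The classes `[t, p]` with `p ∈ A` and `t j = 1` for all `j ∉ N`. -/
def torusOver (N : Set (Facet C)) (A : Set E) : Set (MomentAngleManifold C) :=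
  {x | ∃ t, ∃ p : C, (p : E) ∈ A ∧ (∀ j ∉ N, t j = 1) ∧ mk t p = x}

end MomentAngleManifold

theorem exists_circle_mul_norm (z : ℂ) : ∃ t : Circle, (t : ℂ) * (‖z‖ : ℂ) = z :=
  ⟨Circle.exp z.arg, by simpa [mul_comm] using Complex.norm_mul_exp_arg_mul_I z⟩

theorem circle_mul_eq_iff {t s : Circle} {r q : ℝ} (hr : 0 ≤ r) (hq : 0 ≤ q) :
    (t : ℂ) * r = s * q ↔ r = q ∧ (r ≠ 0 → t = s) := by
  constructor
  · intro h
    have hrq : r = q := by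
      simpa only [norm_mul, Circle.norm_coe, one_mul, Complex.norm_of_nonneg, hr, hq]
        using congrArg norm h
    subst hrq
    exact ⟨rfl, fun h0 => Circle.ext (mul_right_cancel₀ (Complex.ofReal_ne_zero.mpr h0) h)⟩
  · rintro ⟨rfl, h⟩
    by_cases h0 : r = 0
    · simp [h0]
    · rw [h h0]

section Polar

variable {V : Type} {K : PreAbstractSimplicialComplex V} {t s : V → Circle} {u v : V → ℝ}

/-- The vector with arguments `t` and absolute values `1 - u`, for `u ≤ 1`. In these coordinates
the moment-angle-complex lies over the cubical complex. -/
def polar (t : V → Circle) (u : V → ℝ) : V → ℂ :=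
  fun j => t j * (1 - u j : ℝ)

theorem norm_polar (hu : u ≤ 1) (j : V) : ‖polar t u j‖ = 1 - u j := by
  have hj : 0 ≤ 1 - u j := sub_nonneg.mpr (hu j)
  rw [polar, norm_mul, Circle.norm_coe, one_mul, Complex.norm_of_nonneg hj]

theorem polar_apply_eq_iff (hu : u ≤ 1) (hv : v ≤ 1) (j : V) :
    polar t u j = polar s v j ↔ u j = v j ∧ (u j ≠ 1 → t j = s j) := by
  have huj : 0 ≤ 1 - u j := sub_nonneg.mpr (hu j)
  have hvj : 0 ≤ 1 - v j := sub_nonneg.mpr (hv j)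
  rw [polar, polar, circle_mul_eq_iff huj hvj, sub_right_inj, sub_ne_zero, ne_comm]

theorem polar_mem (t : V → Circle) (hu : u ∈ cubicalComplex (simplices K)) :
    polar t u ∈ MomentAngleComplex K := by
  have hu01 := cubicalComplex_subset_Icc _ hu
  obtain ⟨τ, hτ, huτ⟩ := mem_cubicalComplex.mp hu
  refine ⟨τ, hτ, fun j _ => ?_, fun j hj => ?_⟩
  · rw [norm_polar hu01.2]
    exact sub_le_self _ (hu01.1 j)
  · rw [norm_polar hu01.2, eq_zero_of_le_indicator huτ hj, sub_zero]

theorem exists_polar_eq {z : V → ℂ} (hz : z ∈ MomentAngleComplex K) :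
    ∃ t, ∃ u ∈ cubicalComplex (simplices K), polar t u = z := by
  obtain ⟨τ, hτ, hle, heq⟩ := hz
  choose t ht using fun j => exists_circle_mul_norm (z j)
  refine ⟨t, fun j => 1 - ‖z j‖, mem_cubicalComplex.mpr ⟨τ, hτ, fun j => ?_, fun j => ?_⟩,
    funext fun j => by rw [polar, sub_sub_cancel, ht]⟩
  all_goals by_cases hj : j ∈ τ
  · exact sub_nonneg.mpr (hle j hj)
  · simp [heq j hj]
  · simp [hj]
  · simp [hj, heq j hj]

end Polar

/-- The map `Θ` from the moment-angle manifold of `P` to the moment-angle-complex of its nerve sends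
`[t, p]` to the point with polar coordinates `t` and `u`, where `u` are the coordinates of `p` given
by the layer integral of `b`. -/
def IsPolarCoordinateMap {E : Type} [NormedAddCommGroup E] [NormedSpace ℝ E] {P : Set E}
    [Finite (Facet P)] (b : Finset (Facet P) → E)
    (Θ : MomentAngleManifold P → MomentAngleComplex (nerveComplex P)) : Prop :=
  ∀ t, ∀ u ∈ cubicalComplex (simplices (nerveComplex P)), ∀ p : P, p = layerIntegral b u →
    (Θ (.mk t p) : Facet P → ℂ) = polar t u

namespace IsSimplePresentation

variable {E : Type} [NormedAddCommGroup E] [NormedSpace ℝ E] [CompleteSpace E] {P : Set E}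
  {ℓ : Facet P → E →ᴬ[ℝ] ℝ} [Finite (Facet P)] {b : Finset (Facet P) → E}

theorem exists_isPolarCoordinateMap (S : IsSimplePresentation P ℓ)
    (h : IsBarycentricSystem ℓ ∅ 0 (simplices (nerveComplex P)) b) :
    ∃ Θ : MomentAngleManifold P ≃ₜ MomentAngleComplex (nerveComplex P),
      IsPolarCoordinateMap b Θ := by
  let κ : cubicalComplex (simplices (nerveComplex P)) ≃ₜ P :=
    h.homeomorph.trans (.setCongr S.eq_slice.symm)
  have hκ (u) : (κ u : E) = layerIntegral b u := rfl
  have hle (p : P) : (κ.symm p : Facet P → ℝ) ≤ 1 :=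
    (cubicalComplex_subset_Icc _ (κ.symm p).2).2
  have hfacet (p : P) (j) : (κ.symm p : Facet P → ℝ) j ≠ 1 ↔ (p : E) ∉ (j : Set E) := by
    rw [S.mem_facet_iff p.2, ← mem_zeroSet, ← κ.apply_symm_apply p, hκ,
      h.zeroSet_layerIntegral (κ.symm p).2, κ.apply_symm_apply, mem_superlevel]
    exact not_congr ⟨fun h => h.ge, (hle p j).antisymm⟩
  refine (MomentAngleManifold.exists_homeomorph S.isCompact
    (fun x => (⟨polar x.1 (κ.symm x.2), polar_mem x.1 (κ.symm x.2).2⟩ :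
      MomentAngleComplex (nerveComplex P))) ?_ ?_ fun t p s q => ?_).imp
    fun Θ hΘ t u hu p hp => ?_
  · refine .subtype_mk (continuous_pi fun j => ?_) _
    have hu : Continuous fun x : (Facet P → Circle) × P => (κ.symm x.2 : Facet P → ℝ) j :=
      (continuous_apply j).comp
        (continuous_subtype_val.comp (κ.symm.continuous.comp continuous_snd))
    unfold polar
    fun_prop
  · rintro ⟨z, hz⟩
    obtain ⟨t, u, hu, rfl⟩ := exists_polar_eq hz
    exact ⟨(t, κ ⟨u, hu⟩), Subtype.ext (by simp only [κ.symm_apply_apply])⟩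
  · rw [Subtype.mk.injEq, funext_iff]
    simp only [polar_apply_eq_iff (hle _) (hle _), hfacet, forall_and]
    rw [← funext_iff, ← Subtype.ext_iff, κ.symm.injective.eq_iff]
  · obtain rfl : p = κ ⟨u, hu⟩ := Subtype.ext hp
    rw [hΘ, κ.symm_apply_apply]

theorem mem_torusOver_iff (S : IsSimplePresentation P ℓ)
    (h : IsBarycentricSystem ℓ ∅ 0 (simplices (nerveComplex P)) b)
    {Θ : MomentAngleManifold P ≃ₜ MomentAngleComplex (nerveComplex P)}
    (hΘ : IsPolarCoordinateMap b Θ) {N : Set (Facet P)} {A : Set E} {v : Facet P → ℝ} (hv : v ≤ 1)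
    (hA : ∀ u ∈ cubicalComplex (simplices (nerveComplex P)),
      layerIntegral b u ∈ A ↔ ∀ j ∉ N, u j = v j) (x : MomentAngleManifold P) :
    x ∈ MomentAngleManifold.torusOver N A ↔ ∀ j ∉ N, (Θ x : Facet P → ℂ) j = polar 1 v j := by
  classical
  have hsurj (p : P) : ∃ u ∈ cubicalComplex (simplices (nerveComplex P)),
      (p : E) = layerIntegral b u :=
    (h.surjOn (S.mem_slice_iff.mpr ⟨p.2, by simp⟩)).imp fun u hu => ⟨hu.1, hu.2.symm⟩
  constructor
  · rintro ⟨t, p, hpA, ht, rfl⟩ j hj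
    obtain ⟨u, hu, hp⟩ := hsurj p
    rw [hΘ t u hu p hp, polar, polar, ht j hj, (hA u hu).mp (hp ▸ hpA) j hj, Pi.one_apply]
  · intro hx
    obtain ⟨t, p, rfl⟩ := MomentAngleManifold.exists_mk x
    obtain ⟨u, hu, hp⟩ := hsurj p
    rw [hΘ t u hu p hp] at hx
    have hu1 := (cubicalComplex_subset_Icc _ hu).2
    have huv : ∀ j ∉ N, u j = v j := fun j hj => ((polar_apply_eq_iff hu1 hv j).mp (hx j hj)).1
    let t' : Facet P → Circle := fun j => if j ∈ N then t j else 1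
    refine ⟨t', p, hp ▸ (hA u hu).mpr huv, fun j hj => if_neg hj,
      Θ.injective (Subtype.ext (funext fun j => ?_))⟩
    rw [hΘ t' u hu p hp, hΘ t u hu p hp]
    by_cases hj : j ∈ N
    · simp [polar, t', hj]
    · rw [hx j hj, polar, polar, huv j hj]
      simp [t', hj]

section Levels

variable [DecidableEq (Facet P)] {σ : Finset (Facet P)} {δ : ℝ}

theorem mem_torusOver_slice_mul_iff (S : IsSimplePresentation P ℓ)
    (h : IsBarycentricSystem ℓ ∅ 0 (simplices (nerveComplex P)) b)
    (hb : IsNormalizedAlong ℓ σ δ (simplices (nerveComplex P)) b) (hδ : 0 < δ)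
    {Θ : MomentAngleManifold P ≃ₜ MomentAngleComplex (nerveComplex P)}
    (hΘ : IsPolarCoordinateMap b Θ) {r : ℝ} (hr0 : 0 ≤ r) (hr1 : r < 1)
    {x : MomentAngleManifold P} :
    x ∈ MomentAngleManifold.torusOver {j | {j} ∈ link (nerveComplex P) σ} (slice ℓ σ (δ * r)) ↔
      ∀ j, {j} ∉ link (nerveComplex P) σ →
        (Θ x : Facet P → ℂ) j = if j ∈ σ then (r : ℂ) else 1 := by
  have hv : (fun j => if j ∈ σ then 1 - r else 0) ≤ 1 := fun j => by
    dsimp only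
    split_ifs <;> simp [hr0]
  refine (S.mem_torusOver_iff h hΘ hv
    (fun u hu => h.layerIntegral_mem_slice_mul_iff hb hδ hr1 hu) x).trans
    (forall₂_congr fun j _ => ?_)
  split_ifs <;> simp [polar, *]

theorem mem_torusOver_slice_iff (S : IsSimplePresentation P ℓ)
    (hflag : IsFlagComplex (nerveComplex P)) (hσ : σ ∈ simplices (nerveComplex P))
    (h : IsBarycentricSystem ℓ ∅ 0 (simplices (nerveComplex P)) b)
    (hb : IsNormalizedAlong ℓ σ δ (simplices (nerveComplex P)) b)
    (hlink : IsBarycentricSystem ℓ σ δ (link (nerveComplex P) σ) b)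
    {Θ : MomentAngleManifold P ≃ₜ MomentAngleComplex (nerveComplex P)}
    (hΘ : IsPolarCoordinateMap b Θ) {x : MomentAngleManifold P} :
    x ∈ MomentAngleManifold.torusOver {j | {j} ∈ link (nerveComplex P) σ} (slice ℓ σ δ) ↔
      ∀ j, {j} ∉ link (nerveComplex P) σ → (Θ x : Facet P → ℂ) j = 1 := by
  refine (S.mem_torusOver_iff h hΘ zero_le_one
    (fun u hu => h.layerIntegral_mem_slice_iff hflag hσ hb hlink hu) x).trans
    (forall₂_congr fun j _ => ?_)
  simp [polar]

end Levels

end IsSimplePresentation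

section Push

theorem exists_push {W : Type} [NormedAddCommGroup W] [NormedSpace ℝ W] [CompleteSpace W] {a : W}
    (ha : ‖a‖ < 1) : ∃ A : W ≃ₜ W, A 0 = a ∧ ∀ y, 1 ≤ ‖y‖ → A y = y := by
  cases subsingleton_or_nontrivial W
  · exact ⟨.refl W, Subsingleton.elim _ _, fun _ _ => rfl⟩
  let A : W → W := fun y => y + max (1 - ‖y‖) 0 • a
  have hA : ApproximatesLinearOn A (ContinuousLinearEquiv.refl ℝ W : W →L[ℝ] W) univ ‖a‖₊ := by
    intro x _ y _
    have hsub : A x - A y - (ContinuousLinearEquiv.refl ℝ W : W →L[ℝ] W) (x - y) =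
        (max (1 - ‖x‖) 0 - max (1 - ‖y‖) 0) • a := by
      simp only [A, ContinuousLinearEquiv.coe_refl, ContinuousLinearMap.id_apply]
      module
    rw [hsub, norm_smul, coe_nnnorm, mul_comm]
    gcongr
    calc |max (1 - ‖x‖) 0 - max (1 - ‖y‖) 0| ≤ |(1 - ‖x‖) - (1 - ‖y‖)| :=
          abs_max_sub_max_le_abs _ _ _
      _ = |‖y‖ - ‖x‖| := by rw [sub_sub_sub_cancel_left]
      _ ≤ ‖x - y‖ := norm_sub_rev x y ▸ abs_norm_sub_norm_le y x
  have ha' : ‖a‖₊ < ‖((ContinuousLinearEquiv.refl ℝ W).symm : W →L[ℝ] W)‖₊⁻¹ := by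
    rw [ContinuousLinearEquiv.refl_symm, ContinuousLinearEquiv.coe_refl,
      ContinuousLinearMap.nnnorm_id, inv_one]
    exact ha
  exact ⟨hA.toHomeomorph A (.inr ha'), (by simp [A] : A 0 = a),
    fun y hy => (by simp [A, hy] : A y = y)⟩

variable {V : Type}

theorem exists_momentAngleComplex_push (K : PreAbstractSimplicialComplex V) (σ : Set V) {a : ℂ}
    (ha : ‖a‖ < 1) :
    ∃ γ : MomentAngleComplex K ≃ₜ MomentAngleComplex K, ∀ z : MomentAngleComplex K,
      (∀ j ∉ σ, (γ z : V → ℂ) j = (z : V → ℂ) j) ∧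
        ∀ j ∈ σ, (γ z : V → ℂ) j = a ↔ (z : V → ℂ) j = 0 := by
  classical
  obtain ⟨A, hA0, hA1⟩ := exists_push ha
  have hfix {y : ℂ} (hy : 1 ≤ ‖A y‖) : A y = y := A.injective (hA1 _ hy)
  have heq (y : ℂ) : ‖A y‖ = 1 ↔ ‖y‖ = 1 :=
    ⟨fun h => hfix h.ge ▸ h, fun h => (hA1 y h.ge).symm ▸ h⟩
  have hle (y : ℂ) : ‖A y‖ ≤ 1 ↔ ‖y‖ ≤ 1 := by
    rw [← not_iff_not, not_le, not_le]
    exact ⟨fun h => hfix h.le ▸ h, fun h => (hA1 y h.le).symm ▸ h⟩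
  let Γ : (V → ℂ) ≃ₜ (V → ℂ) := .piCongrRight fun j => if j ∈ σ then A else .refl ℂ
  have hΓ (z j) : Γ z j = if j ∈ σ then A (z j) else z j := by
    change (if j ∈ σ then A else Homeomorph.refl ℂ) (z j) = _
    split_ifs <;> rfl
  have hmem (z) : z ∈ MomentAngleComplex K ↔ Γ z ∈ MomentAngleComplex K := by
    have hΓle (j) : ‖Γ z j‖ ≤ 1 ↔ ‖z j‖ ≤ 1 := by rw [hΓ]; split_ifs; exacts [hle _, .rfl]
    have hΓeq (j) : ‖Γ z j‖ = 1 ↔ ‖z j‖ = 1 := by rw [hΓ]; split_ifs; exacts [heq _, .rfl]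
    simp only [MomentAngleComplex, mem_ofPred_eq, hΓle, hΓeq]
  refine ⟨Γ.subtype hmem, fun z => ⟨fun j hj => ?_, fun j hj => ?_⟩⟩
  · exact (hΓ z j).trans (if_neg hj)
  · change Γ z j = a ↔ _
    rw [hΓ, if_pos hj, ← hA0, A.injective.eq_iff]

end Push

namespace IsSimplePresentation

variable {E : Type} [NormedAddCommGroup E] [NormedSpace ℝ E] [CompleteSpace E] {P : Set E}
  {ℓ : Facet P → E →ᴬ[ℝ] ℝ} [Finite (Facet P)]

theorem exists_homeomorph_torusOver [DecidableEq (Facet P)] (S : IsSimplePresentation P ℓ)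
    (hflag : IsFlagComplex (nerveComplex P)) {σ : Finset (Facet P)}
    (hσ : σ ∈ simplices (nerveComplex P)) :
    ∃ H : MomentAngleManifold P ≃ₜ MomentAngleComplex (nerveComplex P), ∀ x,
      x ∈ MomentAngleManifold.torusOver {j | {j} ∈ link (nerveComplex P) σ} (slice ℓ σ 0) ↔
        ∀ j, {j} ∉ link (nerveComplex P) σ → (H x : Facet P → ℂ) j = 1 := by
  obtain ⟨ε, hε : 0 < ε, hnormalized⟩ :=
    mem_nhdsGT_iff_exists_Ioo_subset.mp (S.eventually_exists_normalized σ)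
  set δ := ε / 4 with hδε
  have hδ : 0 < δ := by positivity
  obtain ⟨b, hb, hbδ⟩ := hnormalized (⟨by positivity, by linarith⟩ : 2 * δ ∈ Ioo 0 ε)
  obtain ⟨b', hb', hbδ'⟩ := hnormalized (⟨hδ, by linarith⟩ : δ ∈ Ioo 0 ε)
  obtain ⟨Θ, hΘ⟩ := S.exists_isPolarCoordinateMap hb
  obtain ⟨Θ', hΘ'⟩ := S.exists_isPolarCoordinateMap hb'
  obtain ⟨γ, hγ⟩ := exists_momentAngleComplex_push (nerveComplex P) (σ : Set (Facet P))
    (a := (1 / 2 : ℝ)) (by norm_num)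
  refine ⟨Θ.trans (γ.trans (Θ.symm.trans Θ')), fun x => ?_⟩
  calc x ∈ MomentAngleManifold.torusOver {j | {j} ∈ link (nerveComplex P) σ} (slice ℓ σ 0)
    _ ↔ ∀ j, {j} ∉ link (nerveComplex P) σ →
          (Θ x : Facet P → ℂ) j = if j ∈ σ then ((0 : ℝ) : ℂ) else 1 := by
      rw [← S.mem_torusOver_slice_mul_iff hb hbδ (by positivity) hΘ le_rfl one_pos, mul_zero]
    _ ↔ ∀ j, {j} ∉ link (nerveComplex P) σ →
          (γ (Θ x) : Facet P → ℂ) j = if j ∈ σ then ((1 / 2 : ℝ) : ℂ) else 1 := by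
      refine forall₂_congr fun j _ => ?_
      split_ifs with hj
      · rw [Complex.ofReal_zero, (hγ (Θ x)).2 j hj]
      · rw [(hγ (Θ x)).1 j hj]
    _ ↔ Θ.symm (γ (Θ x)) ∈
          MomentAngleManifold.torusOver {j | {j} ∈ link (nerveComplex P) σ} (slice ℓ σ δ) := by
      have hδ2 : 2 * δ * (1 / 2) = δ := by ring
      rw [← hδ2, S.mem_torusOver_slice_mul_iff hb hbδ (by positivity) hΘ (by norm_num)
        (by norm_num), Θ.apply_symm_apply]
    _ ↔ ∀ j, {j} ∉ link (nerveComplex P) σ →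
          (Θ' (Θ.symm (γ (Θ x))) : Facet P → ℂ) j = 1 :=
      S.mem_torusOver_slice_iff hflag hσ hb' hbδ'
        (hb'.slice_link hbδ' hδ (by linarith) hb hbδ) hΘ'

end IsSimplePresentation

end MomentAngleHomeomorphism

section FaceEmbedding

open Set Topology

theorem extend_comp_of_eq_one {V W M : Type} [One M] {φ : V → W} (hφ : Function.Injective φ)
    {f : W → M} (hf : ∀ j ∉ range φ, f j = 1) : Function.extend φ (f ∘ φ) 1 = f := by
  funext j
  by_cases hj : j ∈ range φ
  · obtain ⟨i, rfl⟩ := hj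
    exact hφ.extend_apply _ _ i
  · rw [Function.extend_apply' _ _ _ hj, Pi.one_apply, hf j hj]

namespace MomentAngleComplex

variable {V W : Type} {K : PreAbstractSimplicialComplex V} {L : PreAbstractSimplicialComplex W}
  {φ : V → W}

theorem comp_mem (hφ : Function.Injective φ)
    (hfull : imageComplex φ K = fullSubcomplex L (range φ)) {z : W → ℂ}
    (hz : z ∈ MomentAngleComplex L) : z ∘ φ ∈ MomentAngleComplex K := by
  classical
  obtain ⟨τ, hτ, hle, heq⟩ := hz
  refine ⟨τ.preimage φ hφ.injOn, fun hne => ?_, fun i hi => hle _ (Finset.mem_preimage.mp hi),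
    fun i hi => heq _ (mt Finset.mem_preimage.mpr hi)⟩
  have hsub : (τ.preimage φ hφ.injOn).image φ ⊆ τ :=
    Finset.image_subset_iff.mpr fun i => Finset.mem_preimage.mp
  have hmem : (τ.preimage φ hφ.injOn).image φ ∈ imageComplex φ K := by
    rw [hfull]
    exact ⟨(L.isRelLowerSet_faces (hτ ((hne.image φ).mono hsub))).2 hsub (hne.image φ), by simp⟩
  obtain ⟨ρ, hρ, himage⟩ := hmem
  obtain rfl : ρ = τ.preimage φ hφ.injOn := Finset.image_injective hφ (by convert himage)
  exact hρ

/-- The restriction `z ↦ z ∘ φ` of coordinates to a full subcomplex, a retraction of the map induced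
by `φ`. -/
def restrict (hφ : Function.Injective φ) (hfull : imageComplex φ K = fullSubcomplex L (range φ)) :
    C(MomentAngleComplex L, MomentAngleComplex K) where
  toFun z := ⟨(z : W → ℂ) ∘ φ, comp_mem hφ hfull z.2⟩
  continuous_toFun := .subtype_mk ((Pi.continuous_precomp φ).comp continuous_subtype_val) _

variable (hφ : IsSimplicialEmbedding K L φ)

theorem leftInverse_restrict_map (hfull : imageComplex φ K = fullSubcomplex L (range φ)) :
    Function.LeftInverse (restrict hφ.injective hfull) (map hφ) :=
  fun z => Subtype.ext (Function.extend_comp hφ.injective (z : V → ℂ) 1)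

theorem mem_range_map_iff (hfull : imageComplex φ K = fullSubcomplex L (range φ))
    (z : MomentAngleComplex L) :
    z ∈ range (map hφ) ↔ ∀ j ∉ range φ, (z : W → ℂ) j = 1 := by
  constructor
  · rintro ⟨z, rfl⟩ j hj
    exact Function.extend_apply' _ _ _ hj
  · exact fun hz => ⟨restrict hφ.injective hfull z,
      Subtype.ext (extend_comp_of_eq_one hφ.injective hz)⟩

end MomentAngleComplex

section

variable {E : Type} [NormedAddCommGroup E] [NormedSpace ℝ E] {P F : Set E} (hFP : F ⊆ P)
  {φ : Facet F → Facet P} (hφ : IsFacetMap P F φ)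

theorem faceEmbedding_mk (t : Facet F → Circle) (p : F) :
    faceEmbedding hFP hφ (.mk t p) = .mk (Function.extend φ t 1) (inclusion hFP p) :=
  rfl

theorem range_faceEmbedding :
    range (faceEmbedding hFP hφ) = MomentAngleManifold.torusOver (range φ) F := by
  ext x
  constructor
  · rintro ⟨y, rfl⟩
    obtain ⟨t, p, rfl⟩ := MomentAngleManifold.exists_mk y
    exact ⟨Function.extend φ t 1, inclusion hFP p, p.2,
      fun j hj => Function.extend_apply' _ _ _ hj, rfl⟩
  · rintro ⟨t, p, hp, ht, rfl⟩
    exact ⟨.mk (t ∘ φ) ⟨p, hp⟩, by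
      rw [faceEmbedding_mk, extend_comp_of_eq_one hφ.injective ht, inclusion_mk]⟩

theorem injective_faceEmbedding : Function.Injective (faceEmbedding hFP hφ) := by
  intro x y hxy
  obtain ⟨t, p, rfl⟩ := MomentAngleManifold.exists_mk x
  obtain ⟨s, q, rfl⟩ := MomentAngleManifold.exists_mk y
  rw [faceEmbedding_mk, faceEmbedding_mk, MomentAngleManifold.mk_eq_mk_iff] at hxy
  refine MomentAngleManifold.mk_eq_mk_iff.mpr ⟨inclusion_injective hFP hxy.1, fun G hG => ?_⟩
  have hφG : (p : E) ∉ (φ G : Set E) := fun h => hG (hφ G ▸ ⟨p.2, h⟩)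
  simpa only [hφ.injective.extend_apply] using hxy.2 (φ G) hφG

theorem isEmbedding_faceEmbedding [T2Space (MomentAngleManifold P)] (hF : IsCompact F) :
    IsEmbedding (faceEmbedding hFP hφ) :=
  have := MomentAngleManifold.compactSpace hF
  ((map_continuous _).isClosedEmbedding (injective_faceEmbedding hFP hφ)).isEmbedding

end

theorem exists_homeomorph_of_mem_range_iff {A B X Y : Type*} [TopologicalSpace A]
    [TopologicalSpace B] [TopologicalSpace X] [TopologicalSpace Y] {f : A → X} {g : B → Y}
    (hf : IsEmbedding f) (hg : IsEmbedding g) (H : X ≃ₜ Y)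
    (hH : ∀ x, x ∈ range f ↔ H x ∈ range g) : ∃ H₁ : A ≃ₜ B, ∀ a, H (f a) = g (H₁ a) := by
  let e : A ≃ₜ B := hf.toHomeomorph.trans ((H.subtype hH).trans hg.toHomeomorph.symm)
  have he (a) : hg.toHomeomorph (e a) = H.subtype hH (hf.toHomeomorph a) :=
    hg.toHomeomorph.apply_symm_apply _
  exact ⟨e, fun a => (congrArg Subtype.val (he a)).symm⟩

theorem IsSimplePresentation.exists_conjugation {E : Type} [NormedAddCommGroup E] [NormedSpace ℝ E]
    [FiniteDimensional ℝ E] {P : Set E} [Finite (Facet P)] {ℓ : Facet P → E →ᴬ[ℝ] ℝ}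
    (S : IsSimplePresentation P ℓ) (hflag : IsFlagComplex (nerveComplex P))
    {σ : Finset (Facet P)} (hσ : σ ∈ simplices (nerveComplex P)) (hFP : slice ℓ σ 0 ⊆ P)
    {φ : Facet (slice ℓ σ 0) → Facet P} (hφ : IsFacetMap P (slice ℓ σ 0) φ) :
    ∃ (H₁ : MomentAngleManifold (slice ℓ σ 0) ≃ₜ MomentAngleComplex (nerveComplex (slice ℓ σ 0)))
      (H₂ : MomentAngleManifold P ≃ₜ MomentAngleComplex (nerveComplex P)),
      ∀ z, H₂ (faceEmbedding hFP hφ z) =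
        MomentAngleComplex.map hφ.isSimplicialEmbedding (H₁ z) := by
  classical
  have := FiniteDimensional.complete ℝ E
  obtain ⟨H₂, hH₂⟩ := S.exists_homeomorph_torusOver hflag hσ
  have := H₂.symm.t2Space
  have hF : IsCompact (slice ℓ σ 0) :=
    S.isCompact.of_isClosed_subset (isClosed_slice ℓ σ 0) hFP
  have hfull := S.imageComplex_facetMap_eq hflag hσ hφ
  have hrange : range φ = {j | {j} ∈ link (nerveComplex P) σ} :=
    Set.ext fun j => S.mem_range_facetMap_iff hσ hφ
  obtain ⟨H₁, hH⟩ := exists_homeomorph_of_mem_range_iff (isEmbedding_faceEmbedding hFP hφ hF)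
    ((MomentAngleComplex.leftInverse_restrict_map hφ.isSimplicialEmbedding hfull).isEmbedding
      (map_continuous _) (map_continuous _)) H₂ fun x => by
    rw [range_faceEmbedding, MomentAngleComplex.mem_range_map_iff _ hfull, hrange]
    exact hH₂ x
  exact ⟨H₁, H₂, hH⟩

open CategoryTheory Simplicial in
theorem isSplitEpi_singularCohomologyMap {X Y : Type} [TopologicalSpace X] [TopologicalSpace Y]
    {i : C(X, Y)} {ρ : C(Y, X)} (h : ρ.comp i = ContinuousMap.id X) (R : Type*) [CommRing R] :
    (singularCohomologyMap R i).IsSplitEpi := by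
  refine ⟨singularCohomologyMap R ρ, fun p x => ?_⟩
  have hcomp : TopCat.toSSet.map (TopCat.ofHom i) ≫ TopCat.toSSet.map (TopCat.ofHom ρ) = 𝟙 _ := by
    rw [← Functor.map_comp, ← TopCat.ofHom_comp, h, TopCat.ofHom_id, CategoryTheory.Functor.map_id]
  induction x using Submodule.Quotient.induction_on with | _ f
  refine congrArg Submodule.Quotient.mk (Subtype.ext (funext fun y => ?_))
  exact congrArg (f : Cochain R _ p)
    (congrArg (fun θ : singularSet X ⟶ singularSet X => θ.app (Opposite.op ⦋p⦌) y) hcomp)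

end FaceEmbedding

end

theorem lemma2p10 {n : ℕ} (P F : Set (EuclideanSpace ℝ (Fin n))) (hP : IsSimplePolytope P)
    (hflag : IsFlagComplex (nerveComplex P)) (hF : IsFace P F) :
    ∃ (φ : Facet F → Facet P) (hφ : IsFacetMap P F φ),
      -- the facet map `φ` is the only one
      (∀ ψ : Facet F → Facet P, IsFacetMap P F ψ → ψ = φ) ∧
      -- `Φ(K_F)` is the full subcomplex of `K_P` on the vertex set `φ(𝓕(F))`
      imageComplex φ (nerveComplex F) = fullSubcomplex (nerveComplex P) (Set.range φ) ∧
      -- the maps induced by the face embedding and by `Φ` are conjugate by homeomorphisms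
      (∃ (H₁ : MomentAngleManifold F ≃ₜ MomentAngleComplex (nerveComplex F))
        (H₂ : MomentAngleManifold P ≃ₜ MomentAngleComplex (nerveComplex P)),
        ∀ z, H₂ (faceEmbedding hF.2.subset hφ z) =
          MomentAngleComplex.map hφ.isSimplicialEmbedding (H₁ z)) ∧
      -- the map of moment-angle manifolds has a retraction
      (∃ ρ : C(MomentAngleManifold P, MomentAngleManifold F),
        ρ.comp (faceEmbedding hF.2.subset hφ) = ContinuousMap.id _) ∧
      -- it induces a split ring epimorphism in cohomology, for all coefficient rings
      ∀ (R : Type*) [CommRing R],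
        (singularCohomologyMap R (faceEmbedding hF.2.subset hφ)).IsSplitEpi := by
  obtain ⟨_, ℓ, S⟩ := hP.exists_presentation
  obtain ⟨σ, hσ, rfl⟩ := S.exists_eq_slice hF
  obtain ⟨φ, hφ⟩ := S.exists_isFacetMap hσ
  have hfull := S.imageComplex_facetMap_eq hflag hσ hφ
  obtain ⟨H₁, H₂, hH⟩ := S.exists_conjugation hflag hσ hF.2.subset hφ
  let r := MomentAngleComplex.restrict hφ.injective hfull
  have hr := MomentAngleComplex.leftInverse_restrict_map hφ.isSimplicialEmbedding hfull
  let ρ : C(MomentAngleManifold P, MomentAngleManifold (slice ℓ σ 0)) :=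
    (H₁.symm : C(_, _)).comp (r.comp (H₂ : C(_, _)))
  have hρ : ρ.comp (faceEmbedding hF.2.subset hφ) = ContinuousMap.id _ := by
    ext x
    change H₁.symm (r (H₂ (faceEmbedding hF.2.subset hφ x))) = x
    rw [hH, hr (H₁ x), H₁.symm_apply_apply]
  exact ⟨φ, hφ, fun ψ hψ => S.facetMap_unique hφ hψ, hfull, ⟨H₁, H₂, hH⟩, ⟨ρ, hρ⟩,
    fun R _ => isSplitEpi_singularCohomologyMap hρ R⟩
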